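/- All groups $G$, $H$ below are finite; $[x,y]=x^{-1}y^{-1}xy$ and $x^z=z^{-1}xz$. For a group $A$ and $n\ge 2$ let $K(A,n)=\{(a_1,\dots,a_n)\in A^n : a_1\cdots a_n\in A'\}$. If $F\to G$ is a free presentation of $G$ ($F$ free, the map surjective) with kernel $N$, put $\tilde K(G,n)=K(F,n)/K(N,n)^{F^n}$, where $K(N,n)^{F^n}$ is the normal closure of $K(N,n)$ in $F^n$. Let $H^*$ be a copy of $H$, with isomorphism $h\mapsto h^*$, and let $\nu(H)$ be the quotient of the free product $H\star H^*$ by the relations $[x,y^*]^z=[x^z,(y^z)^*]=[x,y^*]^{(z^*)}$ for $x,y,z\in H$. Put $\tau(H)=\nu(H)/\langle [x,x^*] : x\in H\rangle$ and $\tau^\flat(H)=\tau(H)/M^\flat(H)$ with $M^\flat(H)=\langle [x,y^*] : x,y\in H,\ [x,y]=1\rangle$. A Schur cover of $G$ is a group $H$ with a subgroup $M\le H'\cap Z(H)$ such that $H/M\cong G$ and $M$ is isomorphic to the Schur multiplier $H^2(G,\mathbb{C}^\times)$. An AI-automorphism of $H$ is an automorphism that induces inversion on $H/H'$. **Proposition.**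 Let $H$ be a Schur cover of a group $G$ with $H/M=G$, and let $\alpha$ be an AI-automorphism of $H$. For all $m_1,m_2\in M$ there are finitely many elements $h_i,k_i\in H$ with $\alpha(m_1m_2)=m_2^{-1}m_1^{-1}\prod_i[h_i,k_i]$, and $$\iota\colon M^2\to\tau^\flat(H),\qquad (m_1,m_2)\mapsto m_1\,m_2^*\,\Bigl(\prod_i\bigl[\alpha^{-1}(h_i),\alpha^{-1}(k_i)^*\bigr]\Bigr)^{-1}$$ is well defined (independent of the choice of the $h_i,k_i$) and is an injective group homomorphism with normal image. For every free presentation of $G$ used to define $\tilde K(G,3)$, $$\tilde K(G,3)\cong \tau^\flat(H)/\operatorname{im}\iota .$$ -/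

import Mathlib

universe u

namespace Liedtke

/-- The commutator `[x, y] = x⁻¹ y⁻¹ x y`. (Mathlib's `⁅x, y⁆` is `x y x⁻¹ y⁻¹`.) -/
def comm {A : Type*} [Group A] (x y : A) : A := x⁻¹ * y⁻¹ * x * y

/-- The conjugate `x ^ z = z⁻¹ x z`. -/
def conj {A : Type*} [Group A] (x z : A) : A := z⁻¹ * x * z

section K

/-- The homomorphism `G ^ n → G / G'` sending a tuple to the class of the product of its
components. -/
def prodAb (G : Type*) [Group G] (n : ℕ) : (Fin n → G) →* Abelianization G :=
  ∏ i : Fin n, Abelianization.of.comp (Pi.evalMonoidHom (fun _ : Fin n => G) i)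

/-- `K(G, n)`, the kernel of `G ^ n → G / G'`. -/
def K (G : Type*) [Group G] (n : ℕ) : Subgroup (Fin n → G) := (prodAb G n).ker

theorem mem_K_iff {G : Type*} [Group G] {n : ℕ} (g : Fin n → G) :
    g ∈ K G n ↔ (List.ofFn g).prod ∈ commutator G := by
  have h : prodAb G n g = Abelianization.of (List.ofFn g).prod := by
    rw [map_list_prod, List.map_ofFn, List.prod_ofFn]
    simp [prodAb, MonoidHom.finsetProd_apply]
  rw [K, MonoidHom.mem_ker, h, ← MonoidHom.mem_ker, Abelianization.ker_of]

/-- `K(N, n)` for a subgroup `N` of `F`, viewed inside `F ^ n`. -/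
def KSub {F : Type*} [Group F] (N : Subgroup F) (n : ℕ) : Subgroup (Fin n → F) :=
  (K N n).map (N.subtype.compLeft (Fin n))

/-- The normal closure of `K(N, n)` in `F ^ n`. -/
def KNormal {F : Type*} [Group F] (N : Subgroup F) (n : ℕ) : Subgroup (Fin n → F) :=
  Subgroup.normalClosure (KSub N n : Set (Fin n → F))

instance {F : Type*} [Group F] (N : Subgroup F) (n : ℕ) : (KNormal N n).Normal :=
  Subgroup.normalClosure_normal

theorem KNormal_le_K {F : Type*} [Group F] (N : Subgroup F) (n : ℕ) :
    KNormal N n ≤ K F n := by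
  have : (K F n).Normal := MonoidHom.normal_ker _
  refine Subgroup.normalClosure_le_normal ?_
  rintro _ ⟨g, hg, rfl⟩
  have hg' : prodAb N n g = 1 := hg
  have : prodAb F n (N.subtype.compLeft (Fin n) g)
      = Abelianization.map N.subtype (prodAb N n g) := by
    simp [prodAb, MonoidHom.finsetProd_apply]
  change prodAb F n (N.subtype.compLeft (Fin n) g) = 1
  rw [this, hg', map_one]

/-- `K̃(G, n) = K(F, n) / K(N, n)^{F ^ n}`, computed from the free presentation
`π : F → G` with `F` free on `X` and `N = ker π`. -/
abbrev KTilde {X G : Type*} [Group G] (π : FreeGroup X →* G) (n : ℕ) : Type _ :=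
  K (FreeGroup X) n ⧸ (KNormal π.ker n).subgroupOf (K (FreeGroup X) n)

end K

section Tau

variable (G : Type*) [Group G]

/-- The defining relators of `ν(G)` in the free product `G ⋆ G*`; the first factor is `G`, the
second one is the copy `G*`. -/
def nuRels : Set (Monoid.Coprod G G) :=
  {w | ∃ x y z : G,
    w = conj (comm (Monoid.Coprod.inl x) (Monoid.Coprod.inr y)) (Monoid.Coprod.inl z)
        * (comm (Monoid.Coprod.inl (conj x z)) (Monoid.Coprod.inr (conj y z)))⁻¹ ∨
    w = conj (comm (Monoid.Coprod.inl x) (Monoid.Coprod.inr y)) (Monoid.Coprod.inr z)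
        * (comm (Monoid.Coprod.inl (conj x z)) (Monoid.Coprod.inr (conj y z)))⁻¹}

/-- The group `ν(G)`. -/
abbrev Nu : Type _ := Monoid.Coprod G G ⧸ Subgroup.normalClosure (nuRels G)

variable {G}

/-- The image of `g ∈ G` in `ν(G)`. -/
def nuL : G →* Nu G := (QuotientGroup.mk' _).comp Monoid.Coprod.inl

/-- The image of `g* ∈ G*` in `ν(G)`. -/
def nuR : G →* Nu G := (QuotientGroup.mk' _).comp Monoid.Coprod.inr

theorem map_comm {A B : Type*} [Group A] [Group B] (f : A →* B) (x y : A) :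
    f (comm x y) = comm (f x) (f y) := by simp [comm]

theorem map_conj {A B : Type*} [Group A] [Group B] (f : A →* B) (x y : A) :
    f (conj x y) = conj (f x) (f y) := by simp [conj]

theorem nu_rel_left (x y z : G) :
    conj (comm (nuL x) (nuR y)) (nuL z) = comm (nuL (conj x z)) (nuR (conj y z)) := by
  have h : (QuotientGroup.mk' (Subgroup.normalClosure (nuRels G)))
      (conj (comm (Monoid.Coprod.inl x) (Monoid.Coprod.inr y)) (Monoid.Coprod.inl z)
        * (comm (Monoid.Coprod.inl (conj x z)) (Monoid.Coprod.inr (conj y z)))⁻¹) = 1 :=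
    (QuotientGroup.eq_one_iff _).2 (Subgroup.subset_normalClosure ⟨x, y, z, Or.inl rfl⟩)
  rw [map_mul, map_inv, mul_inv_eq_one, map_conj, map_comm, map_comm] at h
  exact h

theorem nu_rel_right (x y z : G) :
    conj (comm (nuL x) (nuR y)) (nuR z) = comm (nuL (conj x z)) (nuR (conj y z)) := by
  have h : (QuotientGroup.mk' (Subgroup.normalClosure (nuRels G)))
      (conj (comm (Monoid.Coprod.inl x) (Monoid.Coprod.inr y)) (Monoid.Coprod.inr z)
        * (comm (Monoid.Coprod.inl (conj x z)) (Monoid.Coprod.inr (conj y z)))⁻¹) = 1 :=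
    (QuotientGroup.eq_one_iff _).2 (Subgroup.subset_normalClosure ⟨x, y, z, Or.inr rfl⟩)
  rw [map_mul, map_inv, mul_inv_eq_one, map_conj, map_comm, map_comm] at h
  exact h

theorem closure_nuL_nuR :
    Subgroup.closure (Set.range (nuL (G := G)) ∪ Set.range (nuR (G := G))) = ⊤ := by
  have h := Monoid.Coprod.range_inl_sup_range_inr (G := G) (H := G)
  rw [Subgroup.closure_union, ← MonoidHom.coe_range, ← MonoidHom.coe_range, Subgroup.closure_eq,
    Subgroup.closure_eq, nuL, nuR, MonoidHom.range_comp, MonoidHom.range_comp, ← Subgroup.map_sup,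
    h, ← MonoidHom.range_eq_map, MonoidHom.range_eq_top]
  exact QuotientGroup.mk'_surjective _

/-- Let `f` map `ν(G)` onto `A`, and let `P` be a relation on `G` that is invariant under
simultaneous conjugation. Then the images of the `[x, y*]` with `P x y` generate a normal
subgroup. -/
theorem normal_closure_comm {A : Type*} [Group A] (f : Nu G →* A) (hf : Function.Surjective f)
    (P : G → G → Prop) (hP : ∀ x y z, P x y → P (conj x z) (conj y z)) :
    (Subgroup.closure {w : A | ∃ x y : G, P x y ∧ w = comm (f (nuL x)) (f (nuR y))}).Normal := by
  set S := {w : A | ∃ x y : G, P x y ∧ w = comm (f (nuL x)) (f (nuR y))} with hS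
  have key : ∀ a : Nu G, ∀ w ∈ S, f a * w * (f a)⁻¹ ∈ S := by
    intro a
    have ha : a ∈ Subgroup.closure (Set.range (nuL (G := G)) ∪ Set.range (nuR (G := G))) := by
      rw [closure_nuL_nuR]; trivial
    have gen : ∀ x y z : G,
        f (nuL z) * comm (f (nuL x)) (f (nuR y)) * (f (nuL z))⁻¹
          = comm (f (nuL (conj x z⁻¹))) (f (nuR (conj y z⁻¹))) ∧
        f (nuR z) * comm (f (nuL x)) (f (nuR y)) * (f (nuR z))⁻¹
          = comm (f (nuL (conj x z⁻¹))) (f (nuR (conj y z⁻¹))) := by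
      intro x y z
      constructor
      · rw [← map_comm f (nuL (conj x z⁻¹)), ← nu_rel_left, map_conj, map_comm f]; simp [conj]
      · rw [← map_comm f (nuL (conj x z⁻¹)), ← nu_rel_right, map_conj, map_comm f]; simp [conj]
    have one : ∀ u ∈ Set.range (nuL (G := G)) ∪ Set.range (nuR (G := G)),
        ∀ w ∈ S, f u * w * (f u)⁻¹ ∈ S := by
      rintro u (⟨z, rfl⟩ | ⟨z, rfl⟩) w ⟨x, y, hxy, rfl⟩
      · exact ⟨_, _, hP _ _ z⁻¹ hxy, (gen x y z).1⟩
      · exact ⟨_, _, hP _ _ z⁻¹ hxy, (gen x y z).2⟩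
    induction ha using Subgroup.closure_induction'' with
    | one => intro w hw; simpa using hw
    | mem u hu => exact one u hu
    | inv_mem u hu =>
      refine one u⁻¹ ?_
      rcases hu with ⟨z, rfl⟩ | ⟨z, rfl⟩
      · exact Or.inl ⟨z⁻¹, map_inv _ _⟩
      · exact Or.inr ⟨z⁻¹, map_inv _ _⟩
    | mul a b _ _ iha ihb =>
      intro w hw
      have := iha _ (ihb w hw)
      simpa [mul_assoc] using this
  refine ⟨fun w hw g => ?_⟩
  obtain ⟨a, rfl⟩ := hf g
  induction hw using Subgroup.closure_induction with
  | mem w hw => exact Subgroup.subset_closure (key a w hw)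
  | one => simp
  | mul u v _ _ hu hv =>
    have := mul_mem hu hv
    simpa [mul_assoc] using this
  | inv u _ hu =>
    have := inv_mem hu
    simpa [mul_assoc] using this

variable (G)

/-- `∇(G)`, the subgroup of `ν(G)` generated by all `[x, x*]`. -/
def nabla : Subgroup (Nu G) := Subgroup.closure {w | ∃ x : G, w = comm (nuL x) (nuR x)}

instance : (nabla G).Normal := by
  have h := normal_closure_comm (MonoidHom.id (Nu G)) Function.surjective_id
    (fun x y : G => x = y) (by rintro x y z rfl; rfl)
  have hS : {w : Nu G | ∃ x y : G, x = y ∧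
      w = comm (MonoidHom.id (Nu G) (nuL x)) (MonoidHom.id (Nu G) (nuR y))}
      = {w | ∃ x : G, w = comm (nuL x) (nuR x)} := by
    ext w; simp
  rw [hS] at h
  exact h

/-- `τ(G) = ν(G) / ∇(G)`. -/
abbrev Tau : Type _ := Nu G ⧸ nabla G

variable {G}

/-- The image of `g ∈ G` in `τ(G)`. -/
def tauL : G →* Tau G := (QuotientGroup.mk' (nabla G)).comp nuL

/-- The image of `g* ∈ G*` in `τ(G)`. -/
def tauR : G →* Tau G := (QuotientGroup.mk' (nabla G)).comp nuR

variable (G)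

/-- `M^♭(G)`, the subgroup of `τ(G)` generated by all `[x, y*]` with `[x, y] = 1`. -/
def MFlat : Subgroup (Tau G) :=
  Subgroup.closure {w | ∃ x y : G, comm x y = 1 ∧ w = comm (tauL x) (tauR y)}

instance : (MFlat G).Normal :=
  normal_closure_comm (QuotientGroup.mk' (nabla G)) (QuotientGroup.mk'_surjective _)
    (fun x y : G => comm x y = 1) (by
      intro x y z h
      have : comm (conj x z) (conj y z) = conj (comm x y) z := by
        simp [comm, conj, mul_assoc]
      rw [this, h]; simp [conj])

/-- `τ^♭(G) = τ(G) / M^♭(G)`. -/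
abbrev TauFlat : Type _ := Tau G ⧸ MFlat G

variable {G}

/-- The image of `g ∈ G` in `τ^♭(G)`. -/
def flatL : G →* TauFlat G := (QuotientGroup.mk' (MFlat G)).comp tauL

/-- The image of `g* ∈ G*` in `τ^♭(G)`. -/
def flatR : G →* TauFlat G := (QuotientGroup.mk' (MFlat G)).comp tauR

end Tau

/-- The Schur multiplier `M(G) = H²(G, ℂˣ)` (trivial action), written additively. The universe
lifts only serve to place `ℤ` and `ℂˣ` in the universe of `G`. -/
noncomputable abbrev SchurMultiplier (G : Type u) [Group G] : Type u :=
  groupCohomology (Rep.trivial (ULift.{u} ℤ) G (ULift.{u} (Additive ℂˣ))) 2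

/-- `p : H → G` is a Schur cover of `G`, with `M = ker p`: it identifies `H / M` with `G`, the
subgroup `M` lies in `H' ∩ Z(H)`, and `M` is isomorphic to the Schur multiplier of `G`. -/
structure IsSchurCover {H G : Type*} [Group H] [Group G] (p : H →* G) : Prop where
  surjective : Function.Surjective p
  ker_le : p.ker ≤ commutator H ⊓ Subgroup.center H
  ker_equiv : Nonempty (p.ker ≃* Multiplicative (SchurMultiplier G))

/-- An AI-automorphism induces inversion on the abelianisation. -/
def IsAIAut {H : Type*} [Group H] (α : H ≃* H) : Prop :=
  ∀ h : H, Abelianization.of (α h) = (Abelianization.of h)⁻¹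

/-- The product `∏ᵢ [hᵢ, kᵢ]` over a list of pairs. -/
def commProd {H : Type*} [Group H] (L : List (H × H)) : H :=
  (L.map fun q => comm q.1 q.2).prod

/-- The product `∏ᵢ [α⁻¹(hᵢ), α⁻¹(kᵢ)*]` in `τ^♭(H)` over a list of pairs. -/
def flatProd {H : Type*} [Group H] (α : H ≃* H) (L : List (H × H)) : TauFlat H :=
  (L.map fun q => comm (flatL (α.symm q.1)) (flatR (α.symm q.2))).prod

end Liedtke

/-! Everything happens inside `H³`. Sending `x` to `(x, 1, α(x))` and `y*` to `(1, y, α(y))`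
respects the relations of `τ^♭(H)`, because a mixed commutator `[x, y*]` goes to `(1, 1, α([x,
y]))`. The resulting map `flatTriple α` has image `K(H, 3)`, since `α` is inversion modulo `H'`
(`flatTriple_range`), and it is injective (`IsSchurCover.flatTriple_injective`). It carries the
prescribed values of `ι` to `(m₁, m₂, m₂⁻¹m₁⁻¹)`. So `ι` can be defined as the pullback of this
central embedding of `M²`, whose image is `K(M, 3)`; independence of choices, injectivity and
normality are then immediate.

Injectivity amounts to the vanishing of the kernel of `[H, H*] → H'` in `τ^♭(H)`. For `F` free of
finite rank and `φ : F → H`, a homomorphism `θ` on `F'` with `[x, y] ↦ [φ(x), φ(y)*]` is built by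
adding one generator at a time (`IsExteriorPair.exists_lift`). With `φ` onto and `N` the kernel of
`F → G`, each kernel element is `θ(w)` with `w ∈ F' ∩ ker φ`. The Hopf formula puts `w` in `[F, N]`,
which `θ` kills because `φ(N) ≤ M` is central.

The Hopf formula `F' ∩ ker φ ≤ [F, N]` (`IsSchurCover.mem_commutator_ker`) comes from transgression:
characters of `M` inject into `H²(G, ℂˣ)`, and a count makes this a bijection. The same formula, for
the given presentation, identifies `K(F, 3)/K(N, 3)^{F³}` with `K(H, 3)/K(M, 3)`
(`IsSchurCover.mem_KNormal_iff`). -/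

namespace Liedtke

open scoped commutatorElement

/-! ### Transgression and the Hopf formula for a Schur cover. -/

section Multiplier

variable {F : Type*} {G : Type u} [Group F] [Group G]

/-- The factor set `(g, h) ↦ s(g) s(h) s(gh)⁻¹` of a section `s` of `π`. -/
def factorSet (π : F →* G) (s : G → F) (hs : ∀ g, π (s g) = g) (g h : G) : π.ker :=
  ⟨s g * s h * (s (g * h))⁻¹, by simp [MonoidHom.mem_ker, hs]⟩

/-- A homomorphism on the kernel of `π` that is invariant under conjugation. -/
def IsInvariantHom (π : F →* G) {B : Type*} [Group B] (χ : π.ker →* B) : Prop :=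
  ∀ (f : F) (n : π.ker), χ (MulAut.conjNormal f n) = χ n

/-- Both sides are `s(g) s(h) s(k) s(ghk)⁻¹`; this becomes the 2-cocycle identity once an invariant
character is applied. -/
theorem factorSet_mul (π : F →* G) (s : G → F) (hs : ∀ g, π (s g) = g) (g h k : G) :
    factorSet π s hs g h * factorSet π s hs (g * h) k
      = MulAut.conjNormal (s g) (factorSet π s hs h k) * factorSet π s hs g (h * k) := by
  ext
  simp [factorSet, MulAut.conjNormal_apply, mul_assoc]

/-- The 2-cocycle obtained from an invariant homomorphism `χ : ker π → ℂˣ` and a factor set. -/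
def cocycleOfHom (π : F →* G) (s : G → F) (hs : ∀ g, π (s g) = g)
    (χ : π.ker →* ℂˣ) (hχ : IsInvariantHom π χ) :
    groupCohomology.cocycles₂ (Rep.trivial (ULift.{u} ℤ) G (ULift.{u} (Additive ℂˣ))) :=
  ⟨fun q => ULift.up (Additive.ofMul (χ (factorSet π s hs q.1 q.2))), by
    rw [groupCohomology.mem_cocycles₂_iff]
    intro g h k
    have := congrArg χ (factorSet_mul π s hs g h k)
    rw [map_mul, map_mul, hχ] at this
    rw [Representation.isTrivial_apply, add_comm]
    exact congrArg (fun z => ULift.up (Additive.ofMul z)) this⟩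

/-- An invariant homomorphism on `ker π` whose factor set is a coboundary extends to the whole
group, hence vanishes on the commutator subgroup. -/
theorem hom_eq_one_of_coboundary (π : F →* G) (s : G → F) (hs : ∀ g, π (s g) = g)
    {B : Type*} [CommGroup B] (χ : π.ker →* B) (hχ : IsInvariantHom π χ) (b : G → B)
    (hb : ∀ g h, χ (factorSet π s hs g h) = b h / b (g * h) * b g)
    (n : π.ker) (hn : (n : F) ∈ commutator F) : χ n = 1 := by
  let r : F → π.ker := fun x => ⟨x * (s (π x))⁻¹, by simp [MonoidHom.mem_ker, hs]⟩
  have hr : ∀ x y, r (x * y)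
      = r x * MulAut.conjNormal (s (π x)) (r y) * factorSet π s hs (π x) (π y) := by
    intro x y
    ext
    simp [r, factorSet, MulAut.conjNormal_apply, mul_assoc]
  -- Correcting `χ(r x)` by `b(π x)` absorbs the factor set, so `f` is multiplicative; on `ker π` it
  -- is `χ`, as `b 1` cancels the factor set at `(1, 1)`.
  let f : F →* B := MonoidHom.mk' (fun x => χ (r x) * b (π x)) (by
    intro x y
    rw [hr, map_mul, map_mul, hχ, hb, map_mul, div_eq_mul_inv]
    have : ∀ a c d e i : B, a * c * (d * i⁻¹ * e) * i = a * e * (c * d) := by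
      intro a c d e i
      rw [mul_assoc, mul_right_comm d, inv_mul_cancel_right]
      simp only [mul_comm, mul_left_comm]
    exact this _ _ _ _ _)
  have hf : f n = χ n := by
    have h1 : χ (factorSet π s hs 1 1) = b 1 := by simp [hb]
    have hn1 : π (n : F) = 1 := n.2
    have h2 : r n * factorSet π s hs 1 1 = n := by
      ext
      simp [r, factorSet, hn1]
    change χ (r n) * b (π n) = χ n
    rw [hn1, ← h1, ← map_mul, h2]
  rw [← hf]
  have : commutator F ≤ f.ker := Abelianization.commutator_subset_ker f
  exact this hn

/-- Two invariant characters of `ker π` with cohomologous factor sets agree on the intersection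
with the commutator subgroup. -/
theorem hom_eq_of_H2π_eq (π : F →* G) (s : G → F) (hs : ∀ g, π (s g) = g)
    (χ₁ χ₂ : π.ker →* ℂˣ) (h₁ : IsInvariantHom π χ₁) (h₂ : IsInvariantHom π χ₂)
    (h : groupCohomology.H2π _ (cocycleOfHom π s hs χ₁ h₁)
      = groupCohomology.H2π _ (cocycleOfHom π s hs χ₂ h₂))
    (n : π.ker) (hn : (n : F) ∈ commutator F) : χ₁ n = χ₂ n := by
  rw [groupCohomology.H2π_eq_iff] at h
  obtain ⟨b, hb⟩ := h
  have hb' : ∀ g h : G, (b h : ULift.{u} (Additive ℂˣ)) - b (g * h) + b g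
      = ULift.up (Additive.ofMul (χ₁ (factorSet π s hs g h)))
        - ULift.up (Additive.ofMul (χ₂ (factorSet π s hs g h))) := by
    intro g h
    have := congrFun hb (g, h)
    rw [groupCohomology.d₁₂_hom_apply, Representation.isTrivial_apply] at this
    exact this
  have := hom_eq_one_of_coboundary π s hs (χ₁ / χ₂)
    (fun f n => by rw [MonoidHom.div_apply, h₁, h₂, MonoidHom.div_apply])
    (fun g => ((b g : ULift.{u} (Additive ℂˣ)).down).toMul)
    (fun g h => (congrArg (fun z : ULift.{u} (Additive ℂˣ) => z.down.toMul) (hb' g h)).symm) n hn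
  rwa [MonoidHom.div_apply, div_eq_one] at this

/-- Characters into `ℚ/ℤ` separate points; composing with `ℚ/ℤ ↪ ℝ/ℤ ≅ Circle ⊂ ℂˣ` keeps the value
nontrivial. -/
theorem exists_character_ne_one {A : Type*} [CommGroup A] {a : A} (ha : a ≠ 1) :
    ∃ χ : A →* ℂˣ, χ a ≠ 1 := by
  obtain ⟨c, hc⟩ := CharacterModule.exists_character_apply_ne_zero_of_ne_zero
    (A := Additive A) (a := Additive.ofMul a) ha
  let j : AddCircle (1 : ℚ) →+ AddCircle (1 : ℝ) :=
    QuotientAddGroup.map _ _ (Rat.castHom ℝ).toAddMonoidHom (by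
      rw [AddSubgroup.zmultiples_le]
      exact ⟨1, by simp⟩)
  have hj : Function.Injective j := by
    rw [injective_iff_map_eq_zero]
    intro x
    induction x using QuotientAddGroup.induction_on with
    | H x =>
      intro hx
      have hx' : ((x : ℝ) : AddCircle (1 : ℝ)) = 0 := hx
      rw [AddCircle.coe_eq_zero_iff] at hx'
      obtain ⟨n, hn⟩ := hx'
      refine (AddCircle.coe_eq_zero_iff (1 : ℚ)).2 ⟨n, ?_⟩
      have : (n : ℝ) = (x : ℝ) := by simpa using hn
      have : ((n : ℚ) : ℝ) = (x : ℝ) := by simpa using this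
      simpa using Rat.cast_injective this
  let e : Multiplicative (AddCircle (1 : ℝ)) →* Circle :=
    { toFun := fun x => AddCircle.toCircle x.toAdd
      map_one' := AddCircle.toCircle_zero
      map_mul' := fun x y => AddCircle.toCircle_add _ _ }
  let d : A →* Multiplicative (AddCircle (1 : ℝ)) :=
    AddMonoidHom.toMultiplicativeRight (j.comp (c : Additive A →+ AddCircle (1 : ℚ)))
  refine ⟨(Circle.toUnits.comp e).comp d, fun h => hc ?_⟩
  have h1 : (AddCircle.toCircle (j (c (Additive.ofMul a))) : ℂ) = 1 := congrArg Units.val h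
  have h2 : AddCircle.toCircle (j (c (Additive.ofMul a))) =
      AddCircle.toCircle (0 : AddCircle (1 : ℝ)) := by
    rw [AddCircle.toCircle_zero]
    exact Circle.ext h1
  exact hj ((AddCircle.injective_toCircle one_ne_zero h2).trans (map_zero j).symm)

/-- Invariant characters separate the elements of `ker π` modulo `[F, ker π]`. -/
theorem exists_invariant_character (π : F →* G) (n : π.ker)
    (hn : (n : F) ∉ ⁅(⊤ : Subgroup F), π.ker⁆) :
    ∃ χ : π.ker →* ℂˣ, IsInvariantHom π χ ∧ χ n ≠ 1 := by
  let S : Subgroup π.ker := ⁅(⊤ : Subgroup F), π.ker⁆.subgroupOf π.ker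
  have hS : ∀ (f : F) (m : π.ker), MulAut.conjNormal f m * m⁻¹ ∈ S := by
    intro f m
    rw [Subgroup.mem_subgroupOf]
    have := Subgroup.commutator_mem_commutator (Subgroup.mem_top f) m.2
    simpa [commutatorElement_def, MulAut.conjNormal_apply] using this
  have hq : ∀ (f : F) (m : π.ker),
      (QuotientGroup.mk' S) (MulAut.conjNormal f m) = QuotientGroup.mk' S m := by
    intro f m
    rw [← mul_inv_eq_one, ← map_inv, ← map_mul]
    exact (QuotientGroup.eq_one_iff _).2 (hS f m)
  -- Conjugation by all of `F`, in particular by `ker π` itself, is trivial modulo `[F, ker π]`.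
  let _ : CommGroup (π.ker ⧸ S) :=
    { (inferInstance : Group (π.ker ⧸ S)) with
      mul_comm := by
        intro a b
        obtain ⟨a, rfl⟩ := QuotientGroup.mk'_surjective S a
        obtain ⟨b, rfl⟩ := QuotientGroup.mk'_surjective S b
        have h := hq a b
        have e : MulAut.conjNormal (a : F) b = a * b * a⁻¹ := by
          ext
          simp [MulAut.conjNormal_apply]
        rw [e, map_mul, map_mul, map_inv, mul_inv_eq_iff_eq_mul] at h
        exact h }
  have hn' : QuotientGroup.mk' S n ≠ 1 := fun h =>
    hn (Subgroup.mem_subgroupOf.1 ((QuotientGroup.eq_one_iff n).1 h))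
  obtain ⟨χ, hχ⟩ := exists_character_ne_one hn'
  exact ⟨χ.comp (QuotientGroup.mk' S), fun f m => congrArg χ (hq f m), hχ⟩

theorem commutatorElement_mul_center {H : Type*} [Group H] {m k : H}
    (hm : m ∈ Subgroup.center H) (hk : k ∈ Subgroup.center H) (a b : H) :
    ⁅a * m, b * k⁆ = ⁅a, b⁆ := by
  rw [Subgroup.mem_center_iff] at hm hk
  have h1 : a * m * (b * k) = a * b * (m * k) := by
    rw [mul_assoc, ← mul_assoc m, ← hm b, mul_assoc b, mul_assoc a]
  have h2 : b * k * (a * m) = b * a * (m * k) := by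
    rw [mul_assoc, ← mul_assoc k, ← hk a, mul_assoc a, hm k, mul_assoc b]
  rw [commutatorElement_def, commutatorElement_def, mul_assoc _ (a * m)⁻¹, ← mul_inv_rev, h1, h2]
  group

variable {H : Type*} [Group H]

/-- Every element of `H` is an element of `φ(F)` times a central one, and central factors do not
change commutators. -/
theorem IsSchurCover.commutator_eq_map {p : H →* G} (hp : IsSchurCover p)
    {π : F →* G} (hπ : Function.Surjective π) {φ : F →* H} (hφ : p.comp φ = π) :
    commutator H = (commutator F).map φ := by
  have key : ∀ h : H, ∃ f : F, ∃ m ∈ Subgroup.center H, h = φ f * m := by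
    intro h
    obtain ⟨f, hf⟩ := hπ (p h)
    refine ⟨f, (φ f)⁻¹ * h, (hp.ker_le ?_).2, by simp⟩
    have : p (φ f) = p h := by rw [← hf, ← hφ]; rfl
    rw [MonoidHom.mem_ker, map_mul, map_inv, this, inv_mul_cancel]
  apply le_antisymm
  · rw [commutator_eq_closure, Subgroup.closure_le]
    rintro _ ⟨a, b, rfl⟩
    obtain ⟨x, m, hm, rfl⟩ := key a
    obtain ⟨y, k, hk, rfl⟩ := key b
    refine ⟨⁅x, y⁆, Subgroup.commutator_mem_commutator (Subgroup.mem_top x)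
      (Subgroup.mem_top y), ?_⟩
    rw [map_commutatorElement, commutatorElement_mul_center hm hk]
  · rw [commutator_def, commutator_def, Subgroup.map_commutator]
    exact Subgroup.commutator_mono le_top le_top

/-- A lift of `π` to a Schur cover is surjective. -/
theorem IsSchurCover.lift_surjective {p : H →* G} (hp : IsSchurCover p)
    {π : F →* G} (hπ : Function.Surjective π) {φ : F →* H} (hφ : p.comp φ = π) :
    Function.Surjective φ := by
  intro h
  obtain ⟨f, hf⟩ := hπ (p h)
  have hm : (φ f)⁻¹ * h ∈ p.ker := by
    have : p (φ f) = p h := by rw [← hf, ← hφ]; rfl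
    rw [MonoidHom.mem_ker, map_mul, map_inv, this, inv_mul_cancel]
  have := (hp.ker_le hm).1
  rw [hp.commutator_eq_map hπ hφ] at this
  obtain ⟨w, -, hw⟩ := this
  exact ⟨f * w, by rw [map_mul, hw, mul_inv_cancel_left]⟩

/-- The Hopf formula for a Schur cover: the kernel of a lift `φ : F → H` of `π` to a Schur cover
meets `F'` only in `[F, ker π]`. -/
theorem IsSchurCover.mem_commutator_ker [Finite H] {p : H →* G} (hp : IsSchurCover p)
    {π : F →* G} (hπ : Function.Surjective π) {φ : F →* H} (hφ : p.comp φ = π)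
    {n : F} (hn : n ∈ commutator F) (hn1 : φ n = 1) : n ∈ ⁅(⊤ : Subgroup F), π.ker⁆ := by
  have hφ' : ∀ x, p (φ x) = π x := fun x => by rw [← hφ]; rfl
  have hker : n ∈ π.ker := by rw [MonoidHom.mem_ker, ← hφ', hn1, map_one]
  obtain ⟨s, hs⟩ := hπ.hasRightInverse
  let φ₀ : π.ker →* p.ker :=
    (φ.comp π.ker.subtype).codRestrict p.ker (fun x => by
      change p (φ x) = 1
      rw [hφ']
      exact x.2)
  have hcomm : ∀ a b : p.ker, a * b = b * a := fun a b =>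
    Subtype.ext (Subgroup.mem_center_iff.1 (hp.ker_le b.2).2 a)
  let _ : CommGroup p.ker := { (inferInstance : Group p.ker) with mul_comm := hcomm }
  have hinv : ∀ ψ : p.ker →* ℂˣ, IsInvariantHom π (ψ.comp φ₀) := by
    intro ψ f m
    have : φ₀ (MulAut.conjNormal f m) = φ₀ m := by
      ext
      change φ (f * m * f⁻¹) = φ m
      have := Subgroup.mem_center_iff.1 (hp.ker_le (φ₀ m).2).2 (φ f)
      rw [map_mul, map_mul, map_inv, mul_inv_eq_iff_eq_mul]
      exact this
    exact congrArg ψ this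
  -- The transgression. It is injective because `M ≤ H' = φ(F')`, so a character of `M` is
  -- determined by its pullback on `F' ∩ ker π`.
  let T : (p.ker →* ℂˣ) → SchurMultiplier G := fun ψ =>
    groupCohomology.H2π _ (cocycleOfHom π s hs (ψ.comp φ₀) (hinv ψ))
  have hT : Function.Injective T := by
    intro ψ₁ ψ₂ h
    have h' := hom_eq_of_H2π_eq π s hs _ _ (hinv ψ₁) (hinv ψ₂) h
    ext m
    have hm := (hp.ker_le m.2).1
    rw [hp.commutator_eq_map hπ hφ] at hm
    obtain ⟨w, hw, hwm⟩ := hm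
    have hwk : w ∈ π.ker := by
      rw [MonoidHom.mem_ker, ← hφ', hwm]
      exact m.2
    have e : φ₀ ⟨w, hwk⟩ = m := Subtype.ext hwm
    have := h' ⟨w, hwk⟩ hw
    rw [MonoidHom.comp_apply, MonoidHom.comp_apply, e] at this
    rw [this]
  obtain ⟨e⟩ := hp.ker_equiv
  have hfin : Finite (SchurMultiplier G) := Finite.of_equiv _ (e.toEquiv.trans Multiplicative.toAdd)
  have hcard : Nat.card (p.ker →* ℂˣ) = Nat.card (SchurMultiplier G) := by
    rw [CommGroup.card_monoidHom_of_hasEnoughRootsOfUnity]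
    exact Nat.card_congr (e.toEquiv.trans Multiplicative.toAdd)
  have hsurj : Function.Surjective T :=
    ((Nat.bijective_iff_injective_and_card T).2 ⟨hT, hcard⟩).2
  -- A separating invariant character `χ` is cohomologous to some pullback `ψ ∘ φ₀`; the two agree
  -- on `F' ∩ ker π`, but the pullback is trivial at `n`.
  by_contra hnot
  obtain ⟨χ, hχ, hχn⟩ := exists_invariant_character π ⟨n, hker⟩ hnot
  obtain ⟨ψ, hψ⟩ := hsurj (groupCohomology.H2π _ (cocycleOfHom π s hs χ hχ))
  have := hom_eq_of_H2π_eq π s hs _ _ (hinv ψ) hχ hψ ⟨n, hker⟩ hn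
  apply hχn
  rw [← this, MonoidHom.comp_apply]
  have : φ₀ ⟨n, hker⟩ = 1 := Subtype.ext hn1
  rw [this, map_one]

end Multiplier

/-! ### Commutator calculus in groups satisfying the relations of `τ(H)`. -/

section ExteriorPair

variable {H T : Type*} [Group H] [Group T]

/-- The group `T` is generated by the images of two homomorphisms `L, R : H → T` satisfying the
relations of `τ(H)`, and `κ : T → H` is a common retraction. -/
structure IsExteriorPair (L R : H →* T) (κ : T →* H) : Prop where
  rel_left : ∀ x y z, conj (comm (L x) (R y)) (L z) = comm (L (conj x z)) (R (conj y z))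
  rel_right : ∀ x y z, conj (comm (L x) (R y)) (R z) = comm (L (conj x z)) (R (conj y z))
  self : ∀ x, comm (L x) (R x) = 1
  generate : Subgroup.closure (Set.range L ∪ Set.range R) = ⊤
  retract_left : ∀ x, κ (L x) = x
  retract_right : ∀ x, κ (R x) = x

/-- The subgroup generated by the mixed commutators `[x, y*]`. -/
def mixedComm (L R : H →* T) : Subgroup T :=
  Subgroup.closure {w | ∃ x y : H, w = comm (L x) (R y)}

theorem conj_mul_left {A : Type*} [Group A] (a b z : A) :
    conj (a * b) z = conj a z * conj b z := by simp [conj, mul_assoc]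

theorem conj_inv_left {A : Type*} [Group A] (a z : A) : conj a⁻¹ z = (conj a z)⁻¹ := by
  simp [conj, mul_assoc]

theorem conj_mul_right {A : Type*} [Group A] (a y z : A) :
    conj a (y * z) = conj (conj a y) z := by simp [conj, mul_assoc]

theorem conj_one_right {A : Type*} [Group A] (a : A) : conj a 1 = a := by simp [conj]

theorem conj_comm {A : Type*} [Group A] (a b z : A) :
    conj (comm a b) z = comm (conj a z) (conj b z) := by simp [conj, comm, mul_assoc]

theorem conj_eq_self_iff {A : Type*} [Group A] (a z : A) : conj a z = a ↔ Commute z a := by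
  rw [conj, mul_assoc, inv_mul_eq_iff_eq_mul]
  exact eq_comm

theorem comm_mul_left {A : Type*} [Group A] (x y z : A) :
    comm (x * y) z = conj (comm x z) y * comm y z := by simp [comm, conj, mul_assoc]

theorem comm_mul_right {A : Type*} [Group A] (x y z : A) :
    comm x (y * z) = comm x z * conj (comm x y) z := by simp [comm, conj, mul_assoc]

theorem inv_comm {A : Type*} [Group A] (x y : A) : (comm x y)⁻¹ = comm y x := by
  simp [comm, mul_assoc]

namespace IsExteriorPair

variable {L R : H →* T} {κ : T →* H} (h : IsExteriorPair L R κ)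
include h

theorem retract_comm (x y : H) : κ (comm (L x) (R y)) = comm x y := by
  rw [map_comm, h.retract_left, h.retract_right]

/-- The defining relations make `L z` and `R z` act alike on mixed commutators, so `T` acts on them
through `κ`. -/
theorem conj_comm_eq (t : T) : ∀ a b : H,
    conj (comm (L a) (R b)) t = comm (L (conj a (κ t))) (R (conj b (κ t))) := by
  have ht : t ∈ Subgroup.closure (Set.range L ∪ Set.range R) := by
    rw [h.generate]
    exact Subgroup.mem_top t
  induction ht using Subgroup.closure_induction'' with
  | one => intro a b; rw [map_one, conj_one_right, conj_one_right, conj_one_right]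
  | mem u hu =>
    intro a b
    rcases hu with ⟨z, rfl⟩ | ⟨z, rfl⟩
    · rw [h.rel_left, h.retract_left]
    · rw [h.rel_right, h.retract_right]
  | inv_mem u hu =>
    intro a b
    rcases hu with ⟨z, rfl⟩ | ⟨z, rfl⟩
    · rw [← map_inv L, h.rel_left, h.retract_left]
    · rw [← map_inv R, h.rel_right, h.retract_right]
  | mul s t _ _ ihs iht =>
    intro a b
    rw [conj_mul_right, ihs, iht, map_mul, conj_mul_right, conj_mul_right]

theorem mixedComm_normal : (mixedComm L R).Normal := by
  refine ⟨fun e he g => ?_⟩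
  induction he using Subgroup.closure_induction with
  | mem w hw =>
    obtain ⟨x, y, rfl⟩ := hw
    have := h.conj_comm_eq g⁻¹ x y
    rw [conj, inv_inv] at this
    rw [this]
    exact Subgroup.subset_closure ⟨_, _, rfl⟩
  | one => simp
  | mul u v _ _ hu hv => simpa [mul_assoc] using mul_mem hu hv
  | inv u _ hu => simpa [mul_assoc] using inv_mem hu

/-- Conjugation on the mixed commutators only depends on the image under `κ`. -/
theorem conj_eq_of_retract_eq {s t : T} (hst : κ s = κ t) {e : T} (he : e ∈ mixedComm L R) :
    conj e s = conj e t := by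
  induction he using Subgroup.closure_induction with
  | mem w hw =>
    obtain ⟨x, y, rfl⟩ := hw
    rw [h.conj_comm_eq, h.conj_comm_eq, hst]
  | one => simp [conj]
  | mul u v _ _ hu hv => rw [conj_mul_left, conj_mul_left, hu, hv]
  | inv u _ hu => rw [conj_inv_left, conj_inv_left, hu]

theorem commute_of_retract_eq_one {t : T} (ht : κ t = 1) {e : T} (he : e ∈ mixedComm L R) :
    Commute t e := by
  rw [← conj_eq_self_iff, h.conj_eq_of_retract_eq (t := 1) (by rw [ht, map_one]) he,
    conj_one_right]

/-- Expand `[xy, (xy)*] = 1`. The terms `[x, x*]` and `[y, y*]` vanish, and what remains is `[x,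
y*][y, x*]` conjugated by `y`. -/
theorem comm_inv (x y : H) : (comm (L x) (R y))⁻¹ = comm (L y) (R x) := by
  have h1 := h.self (x * y)
  rw [map_mul, map_mul, comm_mul_left, comm_mul_right, comm_mul_right, h.self, h.self] at h1
  have c1 : ∀ z : T, conj 1 z = 1 := fun z => by simp [conj]
  rw [c1, mul_one, one_mul, h.rel_left, ← h.rel_right, ← conj_mul_left] at h1
  rw [inv_eq_iff_mul_eq_one]
  have h2 : (comm (L y) (R x))⁻¹ = comm (L x) (R y) := by
    simpa [conj, mul_assoc, mul_eq_one_iff_eq_inv] using h1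
  rw [← h2, inv_mul_cancel]

/-- `[[x, y], z*] = [x, y*]⁻¹ [x, y*]ᶻ`. -/
theorem comm_comm_left (x y z : H) :
    comm (L (comm x y)) (R z) = (comm (L x) (R y))⁻¹ * conj (comm (L x) (R y)) (R z) := by
  have e1 : comm x y = x⁻¹ * conj x y := by simp [comm, conj, mul_assoc]
  have e2 : conj (comm (L x) (R z)) (L (comm x y))
      = conj (comm (L x) (R z)) (comm (L x) (R y)) := by
    rw [h.conj_comm_eq, h.conj_comm_eq, h.retract_comm, h.retract_left]
  have e3 : comm (L x⁻¹) (R z) = (conj (comm (L x) (R z)) (L x⁻¹))⁻¹ := by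
    simp [comm, conj, mul_assoc]
  -- Two expansions of `[x, (yz)*]`, the second using `yz = (y z y⁻¹) y`.
  have e4 : comm (L x) (R z) * conj (comm (L x) (R y)) (R z)
      = comm (L x) (R y) * comm (L (conj x y)) (R z) := by
    rw [← comm_mul_right, ← map_mul]
    have : y * z = conj z y⁻¹ * y := by simp [conj]
    rw [this, map_mul, comm_mul_right, h.rel_right, ← conj_mul_right, inv_mul_cancel,
      conj_one_right]
  rw [e1, map_mul, comm_mul_left, e3, conj_inv_left, ← conj_mul_right, ← map_mul, ← e1, e2,
    eq_inv_mul_iff_mul_eq]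
  have e5 : conj (comm (L x) (R z)) (comm (L x) (R y))
      = (comm (L x) (R y))⁻¹ * (comm (L x) (R z) * comm (L x) (R y)) := mul_assoc _ _ _
  rw [e5, mul_inv_rev, mul_inv_rev, inv_inv]
  simp only [mul_assoc]
  rw [mul_inv_cancel_left, ← e4, inv_mul_cancel_left]

/-- The elements `κ(e)*⁻¹ e` commute with `L(H)`. -/
theorem commute_left {e : T} (he : e ∈ mixedComm L R) (z : H) :
    Commute (L z) ((R (κ e))⁻¹ * e) := by
  induction he using Subgroup.closure_induction with
  | mem w hw =>
    obtain ⟨x, y, rfl⟩ := hw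
    have hc : Commute ((R (comm x y))⁻¹ * comm (L x) (R y)) (comm (L (comm x y)) (R z)) :=
      h.commute_of_retract_eq_one
        (by rw [map_mul, map_inv, h.retract_right, h.retract_comm, inv_mul_cancel])
        (Subgroup.subset_closure ⟨_, _, rfl⟩)
    -- Conjugation by `L z` multiplies both `R([x, y])` and `[x, y*]` on the right by the same
    -- factor `[[x, y], z*]`, which `hc` allows to cancel.
    have e1 : conj (R (comm x y)) (L z) = R (comm x y) * comm (L (comm x y)) (R z) := by
      rw [← h.comm_inv, inv_comm]
      simp [conj, comm, mul_assoc]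
    have e2 : conj (comm (L x) (R y)) (L z)
        = comm (L x) (R y) * comm (L (comm x y)) (R z) := by
      rw [h.comm_comm_left, mul_inv_cancel_left, h.rel_left, h.rel_right]
    rw [h.retract_comm, ← conj_eq_self_iff, conj_mul_left, conj_inv_left, e1, e2, mul_inv_rev,
      mul_assoc, inv_mul_eq_iff_eq_mul, ← hc.eq, mul_assoc]
  | one => simp
  | mul u v hu hv ihu ihv =>
    have hc : Commute ((R (κ u))⁻¹ * u) v :=
      h.commute_of_retract_eq_one (by rw [map_mul, map_inv, h.retract_right, inv_mul_cancel]) hv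
    have : (R (κ (u * v)))⁻¹ * (u * v) = ((R (κ v))⁻¹ * v) * ((R (κ u))⁻¹ * u) := by
      rw [mul_assoc, ← hc.eq, map_mul, map_mul, mul_inv_rev]
      simp only [mul_assoc]
    rw [this]
    exact ihv.mul_right ihu
  | inv u hu ihu =>
    have hc : Commute ((R (κ u))⁻¹ * u) u⁻¹ :=
      h.commute_of_retract_eq_one (by rw [map_mul, map_inv, h.retract_right, inv_mul_cancel])
        (inv_mem hu)
    have : (R (κ u⁻¹))⁻¹ * u⁻¹ = ((R (κ u))⁻¹ * u)⁻¹ := by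
      have := hc.eq
      rw [mul_inv_cancel_right] at this
      rw [map_inv, map_inv, inv_inv, mul_inv_rev, inv_inv, ← inv_inj, mul_inv_rev, mul_inv_rev,
        inv_inv]
      nth_rewrite 1 [this]
      simp
    rw [this]
    exact ihu.inv_right

end IsExteriorPair

/-- A group homomorphism on `F'` (given as a function on `F`) sending `[x, y]` to
`[φ(x), φ(y)*]`. -/
structure IsCommutatorLift {F : Type*} [Group F] (L R : H →* T) (φ : F →* H) (θ : F → T) :
    Prop where
  map_mul : ∀ u ∈ commutator F, ∀ v ∈ commutator F, θ (u * v) = θ u * θ v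
  map_comm : ∀ x y, θ (comm x y) = comm (L (φ x)) (R (φ y))

theorem comm_mem_commutator {F : Type*} [Group F] (x y : F) : comm x y ∈ commutator F := by
  have := Subgroup.commutator_mem_commutator (Subgroup.mem_top x⁻¹) (Subgroup.mem_top y⁻¹)
  rw [commutator_def]
  simpa [comm, commutatorElement_def] using this

theorem commutator_eq_closure_comm (F : Type*) [Group F] :
    commutator F = Subgroup.closure {w | ∃ x y : F, w = comm x y} := by
  apply le_antisymm
  · rw [commutator_eq_closure, Subgroup.closure_le]
    rintro _ ⟨a, b, rfl⟩
    exact Subgroup.subset_closure ⟨a⁻¹, b⁻¹, by simp [comm, commutatorElement_def]⟩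
  · rw [Subgroup.closure_le]
    rintro _ ⟨a, b, rfl⟩
    exact comm_mem_commutator a b

namespace IsCommutatorLift

variable {F : Type*} [Group F] {L R : H →* T} {φ : F →* H} {θ : F → T}

theorem map_one (hθ : IsCommutatorLift L R φ θ) : θ 1 = 1 := by
  have := hθ.map_mul 1 (one_mem _) 1 (one_mem _)
  rwa [mul_one, left_eq_mul] at this

theorem map_inv (hθ : IsCommutatorLift L R φ θ) {u : F} (hu : u ∈ commutator F) :
    θ u⁻¹ = (θ u)⁻¹ := by
  rw [eq_inv_iff_mul_eq_one, ← hθ.map_mul _ (inv_mem hu) _ hu, inv_mul_cancel, hθ.map_one]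

theorem mem_mixedComm (hθ : IsCommutatorLift L R φ θ) {u : F} (hu : u ∈ commutator F) :
    θ u ∈ mixedComm L R := by
  rw [commutator_eq_closure_comm] at hu
  induction hu using Subgroup.closure_induction with
  | mem w hw =>
    obtain ⟨x, y, rfl⟩ := hw
    rw [hθ.map_comm]
    exact Subgroup.subset_closure ⟨_, _, rfl⟩
  | one => rw [hθ.map_one]; exact one_mem _
  | mul u v hu hv ihu ihv =>
    rw [← commutator_eq_closure_comm] at hu hv
    rw [hθ.map_mul _ hu _ hv]
    exact mul_mem ihu ihv
  | inv u hu ih =>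
    rw [← commutator_eq_closure_comm] at hu
    rw [hθ.map_inv hu]
    exact inv_mem ih

theorem retract_apply (hθ : IsCommutatorLift L R φ θ) {κ : T →* H} (h : IsExteriorPair L R κ)
    {u : F} (hu : u ∈ commutator F) : κ (θ u) = φ u := by
  rw [commutator_eq_closure_comm] at hu
  induction hu using Subgroup.closure_induction with
  | mem w hw =>
    obtain ⟨x, y, rfl⟩ := hw
    rw [hθ.map_comm, h.retract_comm, Liedtke.map_comm]
  | one => rw [hθ.map_one, _root_.map_one, _root_.map_one]
  | mul u v hu hv ihu ihv =>
    rw [← commutator_eq_closure_comm] at hu hv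
    rw [hθ.map_mul _ hu _ hv, _root_.map_mul, _root_.map_mul, ihu, ihv]
  | inv u hu ih =>
    rw [← commutator_eq_closure_comm] at hu
    rw [hθ.map_inv hu, _root_.map_inv, _root_.map_inv, ih]

/-- Any `t` above `φ(f)` may be used, since conjugation on mixed commutators depends only on `κ t`.
Choosing `t` freely is what the construction of lifts needs. -/
theorem map_conj (hθ : IsCommutatorLift L R φ θ) {κ : T →* H} (h : IsExteriorPair L R κ)
    {u : F} (hu : u ∈ commutator F) (f : F) (t : T) (ht : κ t = φ f) :
    θ (conj u f) = conj (θ u) t := by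
  have hn : ∀ w ∈ commutator F, conj w f ∈ commutator F := fun w hw => by
    have := (inferInstance : (commutator F).Normal).conj_mem w hw f⁻¹
    rwa [inv_inv] at this
  rw [commutator_eq_closure_comm] at hu
  induction hu using Subgroup.closure_induction with
  | mem w hw =>
    obtain ⟨x, y, rfl⟩ := hw
    rw [conj_comm, hθ.map_comm, hθ.map_comm, h.conj_comm_eq, ht, Liedtke.map_conj φ x,
      Liedtke.map_conj φ y]
  | one =>
    have c1 : conj (1 : F) f = 1 := by simp [conj]
    rw [c1, hθ.map_one]
    simp [conj]
  | mul u v hu hv ihu ihv =>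
    rw [← commutator_eq_closure_comm] at hu hv
    rw [conj_mul_left, hθ.map_mul _ (hn _ hu) _ (hn _ hv), hθ.map_mul _ hu _ hv, conj_mul_left,
      ihu, ihv]
  | inv u hu ih =>
    rw [← commutator_eq_closure_comm] at hu
    rw [conj_inv_left, hθ.map_inv (hn _ hu), hθ.map_inv hu, conj_inv_left, ih]

end IsCommutatorLift

/-- It suffices to check the values of a commutator lift on pairs of generators, provided that it
is equivariant. -/
theorem isCommutatorLift_of_generators {F : Type*} [Group F] {L R : H →* T} {κ : T →* H}
    (h : IsExteriorPair L R κ) {φ : F →* H} {θ : F → T}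
    (hmul : ∀ u ∈ commutator F, ∀ v ∈ commutator F, θ (u * v) = θ u * θ v)
    (hconj : ∀ u ∈ commutator F, ∀ f, θ (conj u f) = conj (θ u) (L (φ f)))
    {S : Set F} (hS : Subgroup.closure S = ⊤)
    (hgen : ∀ x ∈ S, ∀ y ∈ S, θ (comm x y) = comm (L (φ x)) (R (φ y))) :
    IsCommutatorLift L R φ θ := by
  refine ⟨hmul, ?_⟩
  have hn : ∀ w ∈ commutator F, ∀ f, conj w f ∈ commutator F := fun w hw f => by
    have := (inferInstance : (commutator F).Normal).conj_mem w hw f⁻¹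
    rwa [inv_inv] at this
  have h1 : θ 1 = 1 := by
    have := hmul 1 (one_mem _) 1 (one_mem _)
    rwa [mul_one, left_eq_mul] at this
  have hmem : ∀ x : F, x ∈ Subgroup.closure S := fun x => hS ▸ Subgroup.mem_top x
  have ml : ∀ a b c, θ (comm (a * b) c) = conj (θ (comm a c)) (L (φ b)) * θ (comm b c) := by
    intro a b c
    rw [comm_mul_left, hmul _ (hn _ (comm_mem_commutator _ _) _) _ (comm_mem_commutator _ _),
      hconj _ (comm_mem_commutator _ _)]
  have mr : ∀ a b c, θ (comm a (b * c)) = θ (comm a c) * conj (θ (comm a b)) (L (φ c)) := by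
    intro a b c
    rw [comm_mul_right, hmul _ (comm_mem_commutator _ _) _ (hn _ (comm_mem_commutator _ _) _),
      hconj _ (comm_mem_commutator _ _)]
  have ml' : ∀ a b c, comm (L (φ (a * b))) (R (φ c))
      = conj (comm (L (φ a)) (R (φ c))) (L (φ b)) * comm (L (φ b)) (R (φ c)) := by
    intro a b c
    rw [map_mul, map_mul, comm_mul_left]
  have mr' : ∀ a b c, comm (L (φ a)) (R (φ (b * c)))
      = comm (L (φ a)) (R (φ c)) * conj (comm (L (φ a)) (R (φ b))) (L (φ c)) := by
    intro a b c
    rw [map_mul, map_mul, comm_mul_right, h.rel_left, h.rel_right]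
  have step : ∀ x ∈ S, ∀ y, θ (comm x y) = comm (L (φ x)) (R (φ y)) := by
    intro x hx y
    induction hmem y using Subgroup.closure_induction with
    | mem y hy => exact hgen x hx y hy
    | one => simp [comm, h1]
    | mul a b _ _ iha ihb => rw [mr, mr', iha, ihb]
    | inv a _ ih =>
      -- Expanding `[x, a a⁻¹] = 1` on both sides leaves the value at `a⁻¹` as the only unknown.
      have e1 := mr x a a⁻¹
      have e2 := mr' x a a⁻¹
      rw [mul_inv_cancel] at e1 e2
      have e3 : θ (comm x 1) = comm (L (φ x)) (R (φ 1)) := by simp [comm, h1]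
      rw [ih, e3, e2] at e1
      exact (mul_right_cancel e1).symm
  intro x y
  induction hmem x using Subgroup.closure_induction with
  | mem x hx => exact step x hx y
  | one => simp [comm, h1]
  | mul a b _ _ iha ihb => rw [ml, ml', iha, ihb]
  | inv a _ ih =>
    have e1 := ml a a⁻¹ y
    have e2 := ml' a a⁻¹ y
    rw [mul_inv_cancel] at e1 e2
    have e3 : θ (comm 1 y) = comm (L (φ 1)) (R (φ y)) := by simp [comm, h1]
    rw [ih, e3, e2] at e1
    exact (mul_left_cancel e1).symm

end ExteriorPair

/-! ### Commutator lifts on free groups of finite rank. -/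

section FreeLift

variable {H T : Type*} [Group H] [Group T] {L R : H →* T} {κ : T →* H}

/-- The homomorphism from the free group on `Option X` to the one on `X` that kills `none`. -/
def forgetNone (X : Type*) : FreeGroup (Option X) →* FreeGroup X :=
  FreeGroup.lift fun o => o.elim 1 FreeGroup.of

/-- The homomorphism `FreeGroup (Option X) → T` that is `L ∘ φ` on `none` and `R ∘ φ` on the
other generators. -/
def mixedHom {X : Type*} (L R : H →* T) (φ : FreeGroup (Option X) →* H) :
    FreeGroup (Option X) →* T :=
  FreeGroup.lift fun o => o.elim (L (φ (FreeGroup.of none)))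
    fun x => R (φ (FreeGroup.of (some x)))

/-- `φ` restricted to the generator `none`. -/
def noneHom {X : Type*} (φ : FreeGroup (Option X) →* H) : FreeGroup (Option X) →* H :=
  (zpowersHom H (φ (FreeGroup.of none))).comp
    (FreeGroup.lift fun o => o.elim (Multiplicative.ofAdd 1) fun _ => 1)

/-- Modulo the mixed commutators `L(H)` and `R(H)` commute, so both sides become homomorphisms and
can be compared on generators. -/
theorem IsExteriorPair.mixedHom_decomp (h : IsExteriorPair L R κ) {X : Type*}
    (φ : FreeGroup (Option X) →* H) (w : FreeGroup (Option X)) :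
    ∃ e ∈ mixedComm L R,
      mixedHom L R φ w = L (noneHom φ w)
        * R (φ (FreeGroup.map some (forgetNone X w))) * e := by
  have hN := h.mixedComm_normal
  let q := QuotientGroup.mk' (mixedComm L R)
  have hcomm : ∀ x y, Commute ((q.comp L) x) ((q.comp R) y) := by
    intro x y
    have h1 : q (comm (L x) (R y)) = 1 :=
      (QuotientGroup.eq_one_iff _).2 (Subgroup.subset_closure ⟨x, y, rfl⟩)
    rw [map_comm, comm] at h1
    rw [mul_assoc, ← mul_inv_rev, inv_mul_eq_one] at h1
    exact h1.symm
  let f : FreeGroup (Option X) →* T ⧸ mixedComm L R :=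
    ((q.comp L).noncommCoprod (q.comp R) hcomm).comp
      ((noneHom φ).prod (φ.comp ((FreeGroup.map some).comp (forgetNone X))))
  have hf : q.comp (mixedHom L R φ) = f := by
    ext o
    cases o <;> simp [f, mixedHom, noneHom, forgetNone]
  have hw := congrArg (fun g => g w) hf
  refine ⟨(L (noneHom φ w) * R (φ (FreeGroup.map some (forgetNone X w))))⁻¹
    * mixedHom L R φ w, ?_, by group⟩
  rw [← QuotientGroup.eq]
  exact hw.symm

/-- `noneHom φ` factors through `ℤ`. -/
theorem noneHom_eq_one {X : Type*} (φ : FreeGroup (Option X) →* H) {w : FreeGroup (Option X)}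
    (hw : w ∈ commutator (FreeGroup (Option X))) : noneHom φ w = 1 := by
  rw [noneHom, MonoidHom.comp_apply, MonoidHom.mem_ker.1
    (Abelianization.commutator_subset_ker _ hw), map_one]

theorem IsExteriorPair.retract_mixedHom (h : IsExteriorPair L R κ) {X : Type*}
    (φ : FreeGroup (Option X) →* H) (w : FreeGroup (Option X)) :
    κ (mixedHom L R φ w) = φ w := by
  have : κ.comp (mixedHom L R φ) = φ := by
    ext o
    cases o <;> simp [mixedHom, h.retract_left, h.retract_right]
  exact congrArg (fun g => g w) this

theorem map_mem_commutator {A B : Type*} [Group A] [Group B] (f : A →* B) {w : A}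
    (hw : w ∈ commutator A) : f w ∈ commutator B := by
  have : (commutator A).map f ≤ commutator B := by
    rw [commutator_def, commutator_def, Subgroup.map_commutator]
    exact Subgroup.commutator_mono le_top le_top
  exact this ⟨w, hw, rfl⟩

/-- Adding one free generator. -/
theorem IsExteriorPair.exists_lift_option (h : IsExteriorPair L R κ) {X : Type*}
    (φ : FreeGroup (Option X) →* H) {θ₀ : FreeGroup X → T}
    (hθ₀ : IsCommutatorLift L R (φ.comp (FreeGroup.map some)) θ₀) :
    ∃ θ, IsCommutatorLift L R φ θ := by
  let F := FreeGroup (Option X)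
  let p : F →* FreeGroup X := forgetNone X
  let v : F →* T := R.comp ((φ.comp (FreeGroup.map some)).comp p)
  let D : F →* T := mixedHom L R φ
  let c : F → T := fun w => (v w)⁻¹ * θ₀ (p w)
  have hp : ∀ {w}, w ∈ commutator F → p w ∈ commutator (FreeGroup X) :=
    fun hw => map_mem_commutator p hw
  have hκv : ∀ w, κ (v w) = φ (FreeGroup.map some (p w)) := fun w => h.retract_right _
  have hκθ : ∀ {w}, w ∈ commutator F → κ (θ₀ (p w)) = φ (FreeGroup.map some (p w)) :=
    fun hw => hθ₀.retract_apply h (hp hw)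
  have hκc : ∀ {w}, w ∈ commutator F → κ (c w) = 1 := fun hw => by
    rw [map_mul, map_inv, hκv, hκθ hw, inv_mul_cancel]
  have hDe : ∀ {w}, w ∈ commutator F → D w * (v w)⁻¹ ∈ mixedComm L R := by
    intro w hw
    obtain ⟨e, he, hD⟩ := h.mixedHom_decomp φ w
    rw [noneHom_eq_one φ hw, map_one, one_mul] at hD
    have : D w * (v w)⁻¹ = v w * e * (v w)⁻¹ := congrArg (· * (v w)⁻¹) hD
    rw [this]
    exact h.mixedComm_normal.conj_mem e he _
  have hmem : ∀ {w}, w ∈ commutator F → D w * c w ∈ mixedComm L R := by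
    intro w hw
    rw [← mul_assoc]
    exact mul_mem (hDe hw) (hθ₀.mem_mixedComm (hp hw))
  have hcE : ∀ {w}, w ∈ commutator F → ∀ {e}, e ∈ mixedComm L R → Commute (c w) e :=
    fun hw _ he => h.commute_of_retract_eq_one (hκc hw) he
  -- The order is reversed; this is what multiplicativity of `D w * c w` requires, because `c a`
  -- commutes with `D b * c b`.
  have hcmul : ∀ {a b}, a ∈ commutator F → b ∈ commutator F → c (a * b) = c b * c a := by
    intro a b ha hb
    have := (hcE ha (hθ₀.mem_mixedComm (hp hb))).eq
    change (v (a * b))⁻¹ * θ₀ (p (a * b)) = _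
    rw [map_mul, map_mul, hθ₀.map_mul _ (hp ha) _ (hp hb), mul_inv_rev, mul_assoc (v b)⁻¹,
      ← mul_assoc (v a)⁻¹, this, ← mul_assoc]
  have hcL : ∀ {w}, w ∈ commutator F → ∀ z, Commute (L z) (c w) := by
    intro w hw z
    have := h.commute_left (hθ₀.mem_mixedComm (hp hw)) z
    rwa [hκθ hw] at this
  refine ⟨fun w => D w * c w, isCommutatorLift_of_generators h ?_ ?_
    (FreeGroup.closure_range_of _) ?_⟩
  · intro a ha b hb
    have := (hcE ha (hmem hb)).eq
    change D (a * b) * c (a * b) = D a * c a * (D b * c b)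
    rw [hcmul ha hb, map_mul, mul_assoc (D a) (c a), this]
    simp only [mul_assoc]
  · intro w hw f
    rw [h.conj_eq_of_retract_eq (t := D f)
      ((h.retract_left _).trans (h.retract_mixedHom φ f).symm) (hmem hw)]
    have e1 : c (conj w f) = conj (c w) (v f) := by
      change (v (conj w f))⁻¹ * θ₀ (p (conj w f)) = _
      rw [map_conj p, hθ₀.map_conj h (hp hw) (p f) (v f) (hκv f), map_conj v, conj_mul_left,
        conj_inv_left]
    obtain ⟨e, he, hD⟩ := h.mixedHom_decomp φ f
    have hDv : D f = L (noneHom φ f) * (v f * e * (v f)⁻¹) * v f := by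
      rw [← mul_assoc, ← mul_assoc, inv_mul_cancel_right]
      exact hD
    -- `D f` and `v f` differ by factors from `L(H)` and from the mixed commutators, all of which
    -- commute with `c w`.
    have e2 : conj (c w) (D f) = conj (c w) (v f) := by
      rw [hDv, conj_mul_right, conj_mul_right, (conj_eq_self_iff _ _).2 (hcL hw _),
        (conj_eq_self_iff _ _).2 (hcE hw (h.mixedComm_normal.conj_mem e he _)).symm]
    change D (conj w f) * c (conj w f) = conj (D w * c w) (D f)
    rw [conj_mul_left, e2, e1, map_conj D]
  · have hDn : D (FreeGroup.of none) = L (φ (FreeGroup.of none)) := FreeGroup.lift_apply_of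
    have hDs : ∀ x, D (FreeGroup.of (some x)) = R (φ (FreeGroup.of (some x))) :=
      fun _ => FreeGroup.lift_apply_of
    have hpn : p (FreeGroup.of none) = 1 := FreeGroup.lift_apply_of
    have hps : ∀ x, p (FreeGroup.of (some x)) = FreeGroup.of x :=
      fun _ => FreeGroup.lift_apply_of
    have c1 : ∀ w, p w = 1 → c w = 1 := by
      intro w hw
      change (R (φ (FreeGroup.map some (p w))))⁻¹ * θ₀ (p w) = 1
      rw [hw, hθ₀.map_one]
      simp
    rintro _ ⟨x, rfl⟩ _ ⟨y, rfl⟩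
    rcases x with - | x <;> rcases y with - | y
    · rw [c1 _ (by rw [map_comm p, hpn]; simp [comm]), h.self]
      simp [comm]
    · rw [c1 _ (by rw [map_comm p, hpn]; simp [comm]), mul_one, map_comm D, hDn, hDs]
    · rw [c1 _ (by rw [map_comm p, hpn]; simp [comm]), mul_one, map_comm D, hDn, hDs, ← inv_comm,
        h.comm_inv]
    · change D _ * ((R (φ (FreeGroup.map some (p _))))⁻¹ * θ₀ (p _)) = _
      rw [map_comm p, hps, hps, hθ₀.map_comm, map_comm D, hDs, hDs, map_comm (FreeGroup.map some),
        FreeGroup.map.of, FreeGroup.map.of, map_comm φ, map_comm R, mul_inv_cancel_left]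
      simp

/-- For a free group `F` of finite rank, every homomorphism `F → H` has a commutator lift. -/
theorem IsExteriorPair.exists_lift (h : IsExteriorPair L R κ) (X : Type*) [Finite X] :
    ∀ φ : FreeGroup X →* H, ∃ θ, IsCommutatorLift L R φ θ := by
  induction X using Finite.induction_empty_option with
  | of_equiv e ih =>
    intro φ
    obtain ⟨θ, hθ⟩ := ih (φ.comp (FreeGroup.freeGroupCongr e).toMonoidHom)
    let g := (FreeGroup.freeGroupCongr e).symm.toMonoidHom
    refine ⟨fun w => θ (g w), ⟨fun u hu v hv => ?_, fun x y => ?_⟩⟩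
    · rw [map_mul, hθ.map_mul _ (map_mem_commutator g hu) _ (map_mem_commutator g hv)]
    · rw [map_comm g, hθ.map_comm]
      have hg : ∀ z, (FreeGroup.freeGroupCongr e).toMonoidHom (g z) = z :=
        (FreeGroup.freeGroupCongr e).apply_symm_apply
      rw [MonoidHom.comp_apply, MonoidHom.comp_apply, hg, hg]
  | h_empty =>
    intro φ
    refine ⟨fun _ => 1, fun _ _ _ _ => (mul_one 1).symm, fun x y => ?_⟩
    rw [Subsingleton.elim x 1, Subsingleton.elim y 1]
    simp [comm]
  | h_option ih =>
    intro φ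
    obtain ⟨θ₀, hθ₀⟩ := ih (φ.comp (FreeGroup.map some))
    exact h.exists_lift_option φ hθ₀

end FreeLift

/-! ### The embedding of `τ^♭(H)` into `H³`. -/

section Flat

variable {H : Type*} [Group H]

/-- The universal property of `τ^♭(H)`. -/
def flatLift {A : Type*} [Group A] (f g : H →* A)
    (h₁ : ∀ x y z, conj (comm (f x) (g y)) (f z) = comm (f (conj x z)) (g (conj y z)))
    (h₂ : ∀ x y z, conj (comm (f x) (g y)) (g z) = comm (f (conj x z)) (g (conj y z)))
    (h₃ : ∀ x y, comm x y = 1 → comm (f x) (g y) = 1) : TauFlat H →* A :=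
  let a : Nu H →* A := QuotientGroup.lift _ (Monoid.Coprod.lift f g) (by
    refine Subgroup.normalClosure_le_normal ?_
    rintro w ⟨x, y, z, rfl | rfl⟩
    · change Monoid.Coprod.lift f g _ = 1
      rw [map_mul, map_inv, mul_inv_eq_one, map_conj, map_comm, map_comm]
      simpa using h₁ x y z
    · change Monoid.Coprod.lift f g _ = 1
      rw [map_mul, map_inv, mul_inv_eq_one, map_conj, map_comm, map_comm]
      simpa using h₂ x y z)
  have haL : ∀ x, a (nuL x) = f x := fun x => Monoid.Coprod.lift_apply_inl f g x
  have haR : ∀ x, a (nuR x) = g x := fun x => Monoid.Coprod.lift_apply_inr f g x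
  let b : Tau H →* A := QuotientGroup.lift (nabla H) a (by
    refine (Subgroup.closure_le _).2 ?_
    rintro w ⟨x, rfl⟩
    change a _ = 1
    rw [map_comm a, haL, haR]
    exact h₃ _ _ (by simp [comm]))
  QuotientGroup.lift (MFlat H) b (by
    refine (Subgroup.closure_le _).2 ?_
    rintro w ⟨x, y, hxy, rfl⟩
    change b _ = 1
    rw [map_comm b]
    change comm (a (nuL x)) (a (nuR y)) = 1
    rw [haL, haR, h₃ _ _ hxy])

theorem flatLift_flatL {A : Type*} [Group A] (f g : H →* A) (h₁ h₂ h₃) (x : H) :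
    flatLift f g h₁ h₂ h₃ (flatL x) = f x :=
  Monoid.Coprod.lift_apply_inl f g x

theorem flatLift_flatR {A : Type*} [Group A] (f g : H →* A) (h₁ h₂ h₃) (x : H) :
    flatLift f g h₁ h₂ h₃ (flatR x) = g x :=
  Monoid.Coprod.lift_apply_inr f g x

/-- The map `τ^♭(H) → H` with `x ↦ x` and `x* ↦ x`. -/
def flatRetract (H : Type*) [Group H] : TauFlat H →* H :=
  flatLift (MonoidHom.id H) (MonoidHom.id H) (fun _ _ _ => conj_comm _ _ _)
    (fun _ _ _ => conj_comm _ _ _) fun _ _ h => h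

theorem comm_flat_eq_one {x y : H} (hxy : comm x y = 1) : comm (flatL x) (flatR y) = 1 :=
  (QuotientGroup.eq_one_iff (N := MFlat H) (comm (tauL x) (tauR y))).2
    (Subgroup.subset_closure ⟨x, y, hxy, rfl⟩)

theorem flat_isExteriorPair (H : Type*) [Group H] :
    IsExteriorPair (flatL (G := H)) flatR (flatRetract H) where
  rel_left x y z :=
    congrArg (fun a => (((a : Nu H) : Tau H) : TauFlat H)) (nu_rel_left x y z)
  rel_right x y z :=
    congrArg (fun a => (((a : Nu H) : Tau H) : TauFlat H)) (nu_rel_right x y z)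
  self x := comm_flat_eq_one (by simp [comm])
  generate := by
    let q : Nu H →* TauFlat H := (QuotientGroup.mk' (MFlat H)).comp (QuotientGroup.mk' (nabla H))
    have hq : Function.Surjective q :=
      (QuotientGroup.mk'_surjective _).comp (QuotientGroup.mk'_surjective _)
    have := congrArg (Subgroup.map q) (closure_nuL_nuR (G := H))
    rw [MonoidHom.map_closure, Set.image_union, ← Set.range_comp, ← Set.range_comp,
      Subgroup.map_top_of_surjective q hq] at this
    exact this
  retract_left x := flatLift_flatL _ _ _ _ _ x
  retract_right x := flatLift_flatR _ _ _ _ _ x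

/-- Modulo the mixed commutators, the products `L x * R y` form a subgroup containing all
generators. -/
theorem IsExteriorPair.exists_decomp {T : Type*} [Group T] {L R : H →* T} {κ : T →* H}
    (h : IsExteriorPair L R κ) (t : T) :
    ∃ x y, ∃ e ∈ mixedComm L R, t = L x * R y * e := by
  have hN := h.mixedComm_normal
  let q := QuotientGroup.mk' (mixedComm L R)
  have hcomm : ∀ x y, Commute ((q.comp L) x) ((q.comp R) y) := by
    intro x y
    have h1 : q (comm (L x) (R y)) = 1 :=
      (QuotientGroup.eq_one_iff _).2 (Subgroup.subset_closure ⟨x, y, rfl⟩)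
    rw [map_comm, comm, mul_assoc, ← mul_inv_rev, inv_mul_eq_one] at h1
    exact h1.symm
  let f : H × H →* T ⧸ mixedComm L R := (q.comp L).noncommCoprod (q.comp R) hcomm
  have ht : t ∈ f.range.comap q := by
    have : Subgroup.closure (Set.range L ∪ Set.range R) ≤ f.range.comap q := by
      rw [Subgroup.closure_le]
      rintro _ (⟨x, rfl⟩ | ⟨x, rfl⟩)
      · exact ⟨(x, 1), by simp [f]⟩
      · exact ⟨(1, x), by simp [f]⟩
    rw [h.generate] at this
    exact this (Subgroup.mem_top t)
  obtain ⟨⟨x, y⟩, hxy⟩ := ht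
  exact ⟨x, y, (L x * R y)⁻¹ * t, QuotientGroup.eq.1 hxy, by group⟩

/-- The map `κ` sends the mixed commutators onto `H'`. -/
theorem IsExteriorPair.map_mixedComm {T : Type*} [Group T] {L R : H →* T} {κ : T →* H}
    (h : IsExteriorPair L R κ) : (mixedComm L R).map κ = commutator H := by
  rw [mixedComm, MonoidHom.map_closure, commutator_eq_closure_comm]
  congr 1
  ext w
  constructor
  · rintro ⟨_, ⟨x, y, rfl⟩, rfl⟩
    exact ⟨x, y, h.retract_comm x y⟩
  · rintro ⟨x, y, rfl⟩
    exact ⟨_, ⟨x, y, rfl⟩, h.retract_comm x y⟩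

/-- For a Schur cover `H`, the kernel of `[H, H*] → H'` in `τ^♭(H)` is trivial, that is, the
Bogomolov multiplier of `H` vanishes. -/
theorem IsSchurCover.flatRetract_injOn {G : Type*} [Group G] [Finite H] {p : H →* G}
    (hp : IsSchurCover p) {e : TauFlat H} (he : e ∈ mixedComm (flatL (G := H)) flatR)
    (he1 : flatRetract H e = 1) : e = 1 := by
  have h := flat_isExteriorPair H
  -- Finiteness of `H` gives this free group finite rank, as `exists_lift` requires.
  let φ : FreeGroup H →* H := FreeGroup.lift id
  have hφ : Function.Surjective φ := fun x => ⟨FreeGroup.of x, FreeGroup.lift_apply_of⟩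
  obtain ⟨θ, hθ⟩ := h.exists_lift H φ
  have key : ∃ w ∈ commutator (FreeGroup H), θ w = e := by
    clear he1
    induction he using Subgroup.closure_induction with
    | mem u hu =>
      obtain ⟨x, y, rfl⟩ := hu
      obtain ⟨x, rfl⟩ := hφ x
      obtain ⟨y, rfl⟩ := hφ y
      exact ⟨comm x y, comm_mem_commutator x y, hθ.map_comm x y⟩
    | one => exact ⟨1, one_mem _, hθ.map_one⟩
    | mul _ _ _ _ iha ihb =>
      obtain ⟨a, ha, rfl⟩ := iha
      obtain ⟨b, hb, rfl⟩ := ihb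
      exact ⟨a * b, mul_mem ha hb, hθ.map_mul a ha b hb⟩
    | inv _ _ ih =>
      obtain ⟨a, ha, rfl⟩ := ih
      exact ⟨a⁻¹, inv_mem ha, hθ.map_inv ha⟩
  obtain ⟨w, hw, rfl⟩ := key
  rw [hθ.retract_apply h hw] at he1
  have hmem := hp.mem_commutator_ker (π := p.comp φ) (hp.surjective.comp hφ) rfl hw he1
  have hle : ∀ {u}, u ∈ ⁅(⊤ : Subgroup (FreeGroup H)), (p.comp φ).ker⁆ →
      u ∈ commutator (FreeGroup H) := fun hu => Subgroup.commutator_mono le_rfl le_top hu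
  rw [Subgroup.commutator_def] at hmem
  clear hw he1 he
  induction hmem using Subgroup.closure_induction with
  | mem u hu =>
    obtain ⟨f, -, n, hn, rfl⟩ := hu
    have e1 : ⁅f, n⁆ = comm f⁻¹ n⁻¹ := by simp [comm, commutatorElement_def]
    -- `φ(n⁻¹)` lies in `M`, hence is central, so the mixed commutator with it is a generator of
    -- `M^♭(H)`.
    have hc := Subgroup.mem_center_iff.1 (hp.ker_le (show φ n⁻¹ ∈ p.ker from inv_mem hn)).2
      (φ f⁻¹)
    rw [e1, hθ.map_comm, comm_flat_eq_one]
    rw [comm, mul_assoc, ← mul_inv_rev, ← hc, inv_mul_cancel]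
  | one => exact hθ.map_one
  | mul a b ha hb iha ihb => rw [hθ.map_mul a (hle ha) b (hle hb), iha, ihb, mul_one]
  | inv a ha ih => rw [hθ.map_inv (hle ha), ih, inv_one]

/-- The homomorphism `x ↦ (x, 1, α(x))`. -/
def tripleL (α : H ≃* H) : H →* (Fin 3 → H) :=
  MonoidHom.mk' (fun x => ![x, 1, α x]) fun x y => by ext i; fin_cases i <;> simp

/-- The homomorphism `y ↦ (1, y, α(y))`. -/
def tripleR (α : H ≃* H) : H →* (Fin 3 → H) :=
  MonoidHom.mk' (fun x => ![1, x, α x]) fun x y => by ext i; fin_cases i <;> simp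

theorem comm_triple (α : H ≃* H) (x y : H) :
    comm (tripleL α x) (tripleR α y) = ![1, 1, α (comm x y)] := by
  ext i
  fin_cases i <;> simp [comm, tripleL, tripleR]

/-- The homomorphism `τ^♭(H) → H³` with `x ↦ (x, 1, α(x))` and `y* ↦ (1, y, α(y))`. -/
def flatTriple (α : H ≃* H) : TauFlat H →* (Fin 3 → H) :=
  flatLift (tripleL α) (tripleR α)
    (fun x y z => by
      rw [comm_triple, comm_triple, ← conj_comm]
      ext i
      fin_cases i <;> simp [conj, tripleL])
    (fun x y z => by
      rw [comm_triple, comm_triple, ← conj_comm]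
      ext i
      fin_cases i <;> simp [conj, tripleR])
    (fun x y hxy => by
      rw [comm_triple, hxy]
      ext i
      fin_cases i <;> simp)

theorem flatTriple_flatL (α : H ≃* H) (x : H) : flatTriple α (flatL x) = ![x, 1, α x] :=
  flatLift_flatL _ _ _ _ _ x

theorem flatTriple_flatR (α : H ≃* H) (x : H) : flatTriple α (flatR x) = ![1, x, α x] :=
  flatLift_flatR _ _ _ _ _ x

theorem flatTriple_mixedComm (α : H ≃* H) {e : TauFlat H}
    (he : e ∈ mixedComm (flatL (G := H)) flatR) :
    flatTriple α e = ![1, 1, α (flatRetract H e)] := by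
  induction he using Subgroup.closure_induction with
  | mem u hu =>
    obtain ⟨x, y, rfl⟩ := hu
    rw [(flat_isExteriorPair H).retract_comm, map_comm, ← comm_triple, flatTriple_flatL,
      flatTriple_flatR]
    rfl
  | one =>
    ext i
    fin_cases i <;> simp
  | mul a b _ _ iha ihb =>
    rw [map_mul, iha, ihb]
    ext i
    fin_cases i <;> simp
  | inv a _ ih =>
    rw [map_inv, ih]
    ext i
    fin_cases i <;> simp

theorem flatTriple_decomp (α : H ≃* H) (x y : H) {e : TauFlat H}
    (he : e ∈ mixedComm (flatL (G := H)) flatR) :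
    flatTriple α (flatL x * flatR y * e) = ![x, y, α (x * y * flatRetract H e)] := by
  rw [map_mul, map_mul, flatTriple_flatL, flatTriple_flatR, flatTriple_mixedComm α he]
  ext i
  fin_cases i <;> simp

/-- The first two coordinates force `x = y = 1` in `L x * R y * e`; the third gives `κ(e) = 1`, and
`κ` is injective on mixed commutators. -/
theorem IsSchurCover.flatTriple_injective {G : Type*} [Group G] [Finite H] {p : H →* G}
    (hp : IsSchurCover p) (α : H ≃* H) : Function.Injective (flatTriple α) := by
  rw [injective_iff_map_eq_one]
  intro t ht
  obtain ⟨x, y, e, he, rfl⟩ := (flat_isExteriorPair H).exists_decomp t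
  rw [flatTriple_decomp α x y he] at ht
  have hx : x = 1 := congrFun ht 0
  have hy : y = 1 := congrFun ht 1
  have h2 : α (x * y * flatRetract H e) = 1 := congrFun ht 2
  subst hx hy
  rw [one_mul, one_mul, MulEquiv.map_eq_one_iff] at h2
  rw [hp.flatRetract_injOn he h2]
  simp

theorem mem_K_three_iff {G : Type*} [Group G] (v : Fin 3 → G) :
    v ∈ K G 3 ↔ v 0 * v 1 * v 2 ∈ commutator G := by
  rw [mem_K_iff]
  simp [List.ofFn_succ, mul_assoc]

/-- Modulo `H'` the third coordinate is the inverse of the product of the first two, by the AI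
property. Conversely the first two coordinates are arbitrary, and the third can be adjusted by all
of `H'` since `κ` maps the mixed commutators onto `H'`. -/
theorem flatTriple_range {α : H ≃* H} (hα : IsAIAut α) : (flatTriple α).range = K H 3 := by
  have hmod : ∀ u : H, u ∈ commutator H ↔ Abelianization.of u = 1 := fun u => by
    rw [← MonoidHom.mem_ker, Abelianization.ker_of]
  have h := flat_isExteriorPair H
  have hs : ∀ u, α u ∈ commutator H ↔ u ∈ commutator H := fun u => by
    rw [hmod, hmod, hα, inv_eq_one]
  ext v
  rw [mem_K_three_iff]
  constructor
  · rintro ⟨t, rfl⟩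
    obtain ⟨x, y, e, he, rfl⟩ := h.exists_decomp t
    have he' : flatRetract H e ∈ commutator H := h.map_mixedComm ▸ ⟨e, he, rfl⟩
    rw [hmod] at he' ⊢
    rw [flatTriple_decomp α x y he]
    change Abelianization.of (x * y * α (x * y * flatRetract H e)) = 1
    rw [map_mul, hα, map_mul _ (x * y), he', mul_one, mul_inv_cancel]
  · intro hv
    have hw : (v 0 * v 1)⁻¹ * α.symm (v 2) ∈ commutator H := by
      rw [hmod] at hv ⊢
      have := hα (α.symm (v 2))
      rw [α.apply_symm_apply, eq_comm, inv_eq_iff_eq_inv] at this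
      rw [map_mul, map_inv, this, ← mul_inv_rev, mul_comm (Abelianization.of (v 2)), ← map_mul, hv,
        inv_one]
    rw [← h.map_mixedComm] at hw
    obtain ⟨e, he, hew⟩ := hw
    refine ⟨flatL (v 0) * flatR (v 1) * e, ?_⟩
    rw [flatTriple_decomp α _ _ he, hew, mul_inv_cancel_left, α.apply_symm_apply]
    ext i
    fin_cases i <;> rfl

end Flat

/-! ### Comparing `K(N, 3)^{F³}` with `K(M, 3)`. -/

section Quotient

variable {G H : Type*} [Group G] [Group H]

/-- The homomorphism `(m₁, m₂) ↦ (m₁, m₂, m₂⁻¹ m₁⁻¹)` on a central kernel; its image is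
`K(M, 3)`. -/
def centralTriple (p : H →* G) (hp : p.ker ≤ Subgroup.center H) :
    p.ker × p.ker →* (Fin 3 → H) :=
  MonoidHom.mk' (fun m => ![(m.1 : H), (m.2 : H), (m.2 : H)⁻¹ * (m.1 : H)⁻¹]) (by
    rintro ⟨a, b⟩ ⟨c, d⟩
    have hb := Subgroup.mem_center_iff.1 (hp (inv_mem b.2))
    have ha := Subgroup.mem_center_iff.1 (hp (inv_mem a.2))
    ext i
    fin_cases i
    · rfl
    · rfl
    · change (b * d : H)⁻¹ * (a * c : H)⁻¹ = (b : H)⁻¹ * (a : H)⁻¹ * ((d : H)⁻¹ * (c : H)⁻¹)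
      rw [mul_inv_rev, mul_inv_rev, hb, mul_assoc, mul_assoc, ← mul_assoc (d : H)⁻¹, ha])

theorem centralTriple_mem_center (p : H →* G) (hp : p.ker ≤ Subgroup.center H)
    (m : p.ker × p.ker) : centralTriple p hp m ∈ Subgroup.center (Fin 3 → H) := by
  rw [Subgroup.mem_center_iff]
  intro v
  ext i
  fin_cases i
  · exact Subgroup.mem_center_iff.1 (hp m.1.2) _
  · exact Subgroup.mem_center_iff.1 (hp m.2.2) _
  · exact Subgroup.mem_center_iff.1 (mul_mem (hp (inv_mem m.2.2)) (hp (inv_mem m.1.2))) _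

theorem centralTriple_injective (p : H →* G) (hp : p.ker ≤ Subgroup.center H) :
    Function.Injective (centralTriple p hp) := fun _ _ h =>
  Prod.ext (Subtype.ext (congrFun h 0)) (Subtype.ext (congrFun h 1))

theorem centralTriple_mem_K (p : H →* G) (hp : p.ker ≤ Subgroup.center H)
    (m : p.ker × p.ker) : centralTriple p hp m ∈ K H 3 := by
  rw [mem_K_three_iff]
  have : (m.1 : H) * m.2 * ((m.2 : H)⁻¹ * (m.1 : H)⁻¹) = 1 := by group
  exact this ▸ one_mem _

theorem centralTriple_range_normal (p : H →* G) (hp : p.ker ≤ Subgroup.center H) :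
    (centralTriple p hp).range.Normal := by
  refine ⟨?_⟩
  rintro _ ⟨m, rfl⟩ g
  rw [Subgroup.mem_center_iff.1 (centralTriple_mem_center p hp m) g, mul_inv_cancel_right]
  exact ⟨m, rfl⟩

/-- The normal closure of `K(N, 3)` contains `(1, 1, [F, N])`. -/
theorem mulSingle_mem_KNormal {F : Type*} [Group F] (N : Subgroup F) {d : F}
    (hd : d ∈ ⁅(⊤ : Subgroup F), N⁆) : (![1, 1, d] : Fin 3 → F) ∈ KNormal N 3 := by
  rw [Subgroup.commutator_def] at hd
  induction hd using Subgroup.closure_induction with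
  | mem u hu =>
    obtain ⟨f, -, n, hn, rfl⟩ := hu
    -- The commutator of `(1, 1, f)` with this element of `K(N, 3)` is `(1, 1, [f, n])`.
    have h1 : (![n⁻¹, 1, n] : Fin 3 → F) ∈ KNormal N 3 := by
      refine Subgroup.subset_normalClosure ⟨![⟨n, hn⟩⁻¹, 1, ⟨n, hn⟩], ?_, ?_⟩
      · exact (mem_K_three_iff _).2 (by simp)
      · ext i
        fin_cases i <;> rfl
    have h2 : (![1, 1, f] : Fin 3 → F) * ![n⁻¹, 1, n] * (![1, 1, f])⁻¹ ∈ KNormal N 3 :=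
      (inferInstance : (KNormal N 3).Normal).conj_mem _ h1 _
    have h3 := mul_mem h2 (inv_mem h1)
    convert h3 using 1
    ext i
    fin_cases i <;> simp [commutatorElement_def]
  | one =>
    convert one_mem (KNormal N 3) using 1
    ext i
    fin_cases i <;> rfl
  | mul a b _ _ iha ihb =>
    convert mul_mem iha ihb using 1
    ext i
    fin_cases i <;> simp
  | inv a _ ih =>
    convert inv_mem ih using 1
    ext i
    fin_cases i <;> simp

/-- As `M` is abelian, `φ` maps `K(N, 3)` into `K(M, 3)`, which is central and so absorbs the normal
closure. Conversely `v = (v₀, v₁, (v₀v₁)⁻¹) · (1, 1, v₀v₁v₂)`, where the first factor is in `K(N,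
3)` and the Hopf formula puts `v₀v₁v₂` in `[F, N]`. -/
theorem IsSchurCover.mem_KNormal_iff [Finite H] {F : Type*} [Group F] {p : H →* G}
    (hp : IsSchurCover p) (hpc : p.ker ≤ Subgroup.center H) {π : F →* G}
    (hπ : Function.Surjective π) {φ : F →* H} (hφ : p.comp φ = π) {v : Fin 3 → F}
    (hv : v ∈ K F 3) :
    v ∈ KNormal π.ker 3 ↔ φ.compLeft (Fin 3) v ∈ (centralTriple p hpc).range := by
  have hφ' : ∀ {x}, φ x ∈ p.ker ↔ x ∈ π.ker := fun {x} => by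
    rw [← hφ]
    rfl
  constructor
  · have hn := (centralTriple_range_normal p hpc).comap (φ.compLeft (Fin 3))
    have : KNormal π.ker 3 ≤ (centralTriple p hpc).range.comap (φ.compLeft (Fin 3)) := by
      refine Subgroup.normalClosure_le_normal ?_
      rintro _ ⟨n, hn, rfl⟩
      have hn' := (mem_K_three_iff n).1 hn
      let ψ : π.ker →* p.ker := (φ.comp π.ker.subtype).codRestrict p.ker fun x => hφ'.2 x.2
      have hab : commutator π.ker ≤ ψ.ker := by
        rw [commutator_eq_closure_comm, Subgroup.closure_le]
        rintro _ ⟨a, b, rfl⟩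
        change ψ _ = 1
        have hc : ψ a * ψ b = ψ b * ψ a :=
          Subtype.ext (Subgroup.mem_center_iff.1 (hpc (ψ b).2) (ψ a))
        rw [map_comm, comm, mul_assoc, ← mul_inv_rev, hc, inv_mul_cancel]
      have h1 : ψ (n 0 * n 1 * n 2) = 1 := hab hn'
      have h2 : φ (n 0) * φ (n 1) * φ (n 2) = 1 := by
        rw [map_mul, map_mul] at h1
        exact congrArg Subtype.val h1
      refine ⟨(ψ (n 0), ψ (n 1)), ?_⟩
      ext i
      fin_cases i
      · rfl
      · rfl
      · change (φ (n 1))⁻¹ * (φ (n 0))⁻¹ = φ (n 2)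
        rw [← mul_inv_rev, inv_eq_of_mul_eq_one_right h2]
    exact fun hv => this hv
  · rintro ⟨⟨a, b⟩, hab⟩
    have h0 : (a : H) = φ (v 0) := congrFun hab 0
    have h1 : (b : H) = φ (v 1) := congrFun hab 1
    have h2 : (b : H)⁻¹ * (a : H)⁻¹ = φ (v 2) := congrFun hab 2
    have k0 : v 0 ∈ π.ker := hφ'.1 (h0 ▸ a.2)
    have k1 : v 1 ∈ π.ker := hφ'.1 (h1 ▸ b.2)
    have hd : v 0 * v 1 * v 2 ∈ ⁅(⊤ : Subgroup F), π.ker⁆ := by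
      refine hp.mem_commutator_ker hπ hφ ((mem_K_three_iff v).1 hv) ?_
      rw [map_mul, map_mul, ← h0, ← h1, ← h2]
      group
    have hk : (![v 0, v 1, (v 0 * v 1)⁻¹] : Fin 3 → F) ∈ KNormal π.ker 3 := by
      refine Subgroup.subset_normalClosure
        ⟨![⟨v 0, k0⟩, ⟨v 1, k1⟩, (⟨v 0, k0⟩ * ⟨v 1, k1⟩)⁻¹], ?_, ?_⟩
      · exact (mem_K_three_iff _).2 (by simp)
      · ext i
        fin_cases i <;> rfl
    convert mul_mem hk (mulSingle_mem_KNormal π.ker hd) using 1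
    ext i
    fin_cases i <;> simp [mul_assoc]

theorem exists_commProd {w : H} (hw : w ∈ commutator H) : ∃ L : List (H × H), commProd L = w := by
  rw [commutator_eq_closure_comm] at hw
  induction hw using Subgroup.closure_induction'' with
  | one => exact ⟨[], rfl⟩
  | mem u hu =>
    obtain ⟨x, y, rfl⟩ := hu
    exact ⟨[(x, y)], by simp [commProd]⟩
  | inv_mem u hu =>
    obtain ⟨x, y, rfl⟩ := hu
    exact ⟨[(y, x)], by simp [commProd, inv_comm]⟩
  | mul a b _ _ iha ihb =>
    obtain ⟨L₁, rfl⟩ := iha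
    obtain ⟨L₂, rfl⟩ := ihb
    exact ⟨L₁ ++ L₂, by simp [commProd]⟩

theorem flatProd_mem (α : H ≃* H) (L : List (H × H)) :
    flatProd α L ∈ mixedComm (flatL (G := H)) flatR := by
  refine Subgroup.list_prod_mem _ ?_
  intro x hx
  obtain ⟨q, -, rfl⟩ := List.mem_map.1 hx
  exact Subgroup.subset_closure ⟨_, _, rfl⟩

/-- The twist by `α⁻¹` in `flatProd` is there to cancel the `α` in the third coordinate of
`flatTriple α`. -/
theorem flatRetract_flatProd (α : H ≃* H) (L : List (H × H)) :
    α (flatRetract H (flatProd α L)) = commProd L := by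
  rw [flatProd, commProd, map_list_prod, map_list_prod, List.map_map, List.map_map]
  congr 1
  refine List.map_congr_left fun q _ => ?_
  change α (flatRetract H (comm _ _)) = _
  rw [(flat_isExteriorPair H).retract_comm]
  simp [comm]

end Quotient

end Liedtke

/-! ### The embedding of `M²` and the final isomorphism. -/

theorem mainTheorem11 {G H X : Type*} [Group G] [Finite G] [Group H] [Finite H]
    (p : H →* G) (hp : Liedtke.IsSchurCover p)
    (α : H ≃* H) (hα : Liedtke.IsAIAut α)
    (π : FreeGroup X →* G) (hπ : Function.Surjective π) :
    (∀ m₁ m₂ : p.ker, ∃ L : List (H × H),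
      α (m₁ * m₂) = (m₂ : H)⁻¹ * (m₁ : H)⁻¹ * Liedtke.commProd L) ∧
    ∃ (ι : p.ker × p.ker →* Liedtke.TauFlat H) (_ : ι.range.Normal),
      Function.Injective ι ∧
      (∀ (m₁ m₂ : p.ker) (L : List (H × H)),
        α (m₁ * m₂) = (m₂ : H)⁻¹ * (m₁ : H)⁻¹ * Liedtke.commProd L →
        ι (m₁, m₂) = Liedtke.flatL (m₁ : H) * Liedtke.flatR (m₂ : H)
          * (Liedtke.flatProd α L)⁻¹) ∧
      Nonempty (Liedtke.KTilde π 3 ≃* Liedtke.TauFlat H ⧸ ι.range) := by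
  open Liedtke in
  have hpc : p.ker ≤ Subgroup.center H := fun x hx => (hp.ker_le hx).2
  constructor
  · intro m₁ m₂
    have hmod : (m₁ : H) * m₂ * α (m₁ * m₂) ∈ commutator H := by
      rw [← Abelianization.ker_of, MonoidHom.mem_ker, map_mul, hα, mul_inv_cancel]
    obtain ⟨L, hL⟩ := exists_commProd hmod
    exact ⟨L, by rw [hL]; group⟩
  have hinj := hp.flatTriple_injective α
  let e : TauFlat H ≃* K H 3 :=
    (MonoidHom.ofInjective hinj).trans (MulEquiv.subgroupCongr (flatTriple_range hα))
  have he : ∀ t, (e t : Fin 3 → H) = flatTriple α t := fun _ => rfl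
  let j : p.ker × p.ker →* K H 3 :=
    (centralTriple p hpc).codRestrict (K H 3) (centralTriple_mem_K p hpc)
  have hj : ∀ m, flatTriple α (e.symm (j m)) = centralTriple p hpc m := fun m => by
    rw [← he, e.apply_symm_apply]
    rfl
  let ι : p.ker × p.ker →* TauFlat H := e.symm.toMonoidHom.comp j
  have hι : ∀ m, flatTriple α (ι m) = centralTriple p hpc m := hj
  have hnormal : ι.range.Normal := by
    refine ⟨?_⟩
    rintro _ ⟨m, rfl⟩ t
    refine ⟨m, hinj ?_⟩
    rw [map_mul, map_mul, map_inv, hι,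
      Subgroup.mem_center_iff.1 (centralTriple_mem_center p hpc m) _, mul_inv_cancel_right]
  refine ⟨ι, hnormal, fun m n h => centralTriple_injective p hpc ?_, ?_, ?_⟩
  · rw [← hι, ← hι, h]
  -- After `flatTriple α` the third coordinate of the formula is `α(m₁m₂)` times the inverse of
  -- `∏[hᵢ, kᵢ]`, that is `m₂⁻¹m₁⁻¹` for every admissible list.
  · intro m₁ m₂ L hL
    apply hinj
    rw [hι, flatTriple_decomp α _ _ (inv_mem (flatProd_mem α L)), map_inv, map_mul α, map_inv,
      flatRetract_flatProd, hL, mul_inv_cancel_right]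
    rfl
  · let φ : FreeGroup X →* H :=
      FreeGroup.lift fun x => Function.surjInv hp.surjective (π (FreeGroup.of x))
    have hφ : p.comp φ = π := by
      ext x
      simp [φ, Function.surjInv_eq]
    have hφs := hp.lift_surjective hπ hφ
    let ρ : K (FreeGroup X) 3 →* K H 3 :=
      ((φ.compLeft (Fin 3)).comp (K (FreeGroup X) 3).subtype).codRestrict (K H 3) fun v => by
        have := map_mem_commutator φ ((mem_K_three_iff v.1).1 v.2)
        rw [map_mul, map_mul] at this
        exact (mem_K_three_iff _).2 this
    have hρ : Function.Surjective ρ := by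
      rintro ⟨u, hu⟩
      have hu' := (mem_K_three_iff u).1 hu
      rw [hp.commutator_eq_map hπ hφ] at hu'
      obtain ⟨w, hw, hwu⟩ := hu'
      obtain ⟨a, ha⟩ := hφs (u 0)
      obtain ⟨b, hb⟩ := hφs (u 1)
      -- Here `w ∈ F'` lifts `u₀u₁u₂`; lifting the coordinates independently need not give a triple
      -- in `K(F, 3)`.
      refine ⟨⟨![a, b, (a * b)⁻¹ * w], (mem_K_three_iff _).2 ?_⟩, Subtype.ext ?_⟩
      · change a * b * ((a * b)⁻¹ * w) ∈ _
        rwa [mul_inv_cancel_left]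
      · ext i
        fin_cases i
        · exact ha
        · exact hb
        · change φ ((a * b)⁻¹ * w) = u 2
          rw [map_mul, hwu, map_inv, map_mul, ha, hb, inv_mul_cancel_left]
    let σ : K (FreeGroup X) 3 →* TauFlat H ⧸ ι.range :=
      (QuotientGroup.mk' ι.range).comp (e.symm.toMonoidHom.comp ρ)
    have hσ : Function.Surjective σ :=
      (QuotientGroup.mk'_surjective _).comp (e.symm.surjective.comp hρ)
    have hker : (KNormal π.ker 3).subgroupOf (K (FreeGroup X) 3) = σ.ker := by
      ext v
      have h1 : v ∈ σ.ker ↔ e.symm (ρ v) ∈ ι.range := QuotientGroup.eq_one_iff _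
      rw [Subgroup.mem_subgroupOf, h1, hp.mem_KNormal_iff hpc hπ hφ v.2]
      constructor
      · rintro ⟨m, hm⟩
        exact ⟨m, congrArg e.symm (Subtype.ext hm : j m = ρ v)⟩
      · rintro ⟨m, hm⟩
        exact ⟨m, congrArg Subtype.val (e.symm.injective hm : j m = ρ v)⟩
    exact ⟨(QuotientGroup.quotientMulEquivOfEq hker).trans
      (QuotientGroup.quotientKerEquivOfSurjective σ hσ)⟩
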